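/- Let $n\ge 3$ and let $a:\mathbb S^{n-2}\to\mathbb R$, where $\mathbb S^{n-2}\subset\mathbb R^{n-1}$ is the unit sphere with surface measure $\sigma$, satisfy $a>0$ a.e., $\ln a\in L^\infty(\mathbb S^{n-2})$, and $\int_{\mathbb S^{n-2}} a\,x_i\,d\sigma=0$ for all $i=1,\dots,n-1$. Call $\lambda\in\mathbb R$ an eigenvalue of $$-\operatorname{div}_{\mathbb S^{n-2}}\big(a\nabla_{\mathbb S^{n-2}}u\big)=\lambda\,a\,u \quad\text{on } \mathbb S^{n-2}$$ if there is $u\in H^1(\mathbb S^{n-2})$, $u\not\equiv0$, with $\int a\nabla u\cdot\nabla v\,d\sigma=\lambda\int a\,u\,v\,d\sigma$ for all $v\in H^1(\mathbb S^{n-2})$. Then there is a smallest nonzero eigenvalue $\lambda_1$, it is given by $$\lambda_1=\inf_{u\in H^1(\mathbb S^{n-2}),\ u\not\equiv 0,\ \int a u\,d\sigma=0}\frac{\int_{\mathbb S^{n-2}}a|\nabla_{\mathbb S^{n-2}}u|^2\,d\sigma}{\int_{\mathbb S^{n-2}}a|u|^2\,d\sigma},$$ and $\lambda_1\le n-2$,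 with equality if and only if $a$ is (a.e. equal to) a constant. Consequently $$\alpha(\lambda_1):=\frac{-(n-1)+\sqrt{(n-1)^2+4\lambda_1}}{2}\in(0,1).$$ -/

import Mathlib

open MeasureTheory
open scoped ContDiff

noncomputable section

/-- The unit sphere of `ℝ^d`; it has dimension `d - 1`. -/
abbrev USphere (d : ℕ) : Type :=
  Metric.sphere (0 : EuclideanSpace ℝ (Fin d)) 1

/-- The surface measure on the unit sphere of `ℝ^d`. -/
def surfMeas (d : ℕ) : Measure (USphere d) :=
  (volume : Measure (EuclideanSpace ℝ (Fin d))).toSphere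

/-- A smooth tangent vector field on the unit sphere, given as the restriction to the sphere of a
smooth vector field on `ℝ^d` (every smooth tangent field on the sphere has such an extension). -/
def IsSmoothTangentField {d : ℕ} (X : EuclideanSpace ℝ (Fin d) → EuclideanSpace ℝ (Fin d)) :
    Prop :=
  ContDiff ℝ ∞ X ∧ ∀ x : USphere d, inner ℝ (X (x : EuclideanSpace ℝ (Fin d))) x.1 = 0

/-- The divergence on the sphere, as the trace of the differential over the tangent space `x^⊥`:
the full trace minus the part in the normal direction `x`. For a tangent field this is the
Riemannian divergence, and it depends only on the restriction of `X` to the sphere. -/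
def sphereDiv {d : ℕ} (X : EuclideanSpace ℝ (Fin d) → EuclideanSpace ℝ (Fin d))
    (x : USphere d) : ℝ :=
  (∑ i : Fin d, (fderiv ℝ X x.1 (EuclideanSpace.single i (1 : ℝ))) i)
    - inner ℝ (fderiv ℝ X x.1 x.1) x.1

/-- `u` belongs to the Sobolev space `H¹` of the unit sphere and `G` is (a representative of) its
weak gradient: `u` and `G` are square integrable, `G` is tangent almost everywhere, and
`∫ u div X = - ∫ ⟨G, X⟩` for every smooth tangent vector field `X`. -/
structure IsH1WithGrad {d : ℕ} (u : USphere d → ℝ) (G : USphere d → EuclideanSpace ℝ (Fin d)) :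
    Prop where
  memLp_fun : MemLp u 2 (surfMeas d)
  memLp_grad : MemLp G 2 (surfMeas d)
  tangent : ∀ᵐ x ∂(surfMeas d), inner ℝ (G x) x.1 = 0
  integral_div : ∀ X : EuclideanSpace ℝ (Fin d) → EuclideanSpace ℝ (Fin d),
    IsSmoothTangentField X →
      ∫ x, u x * sphereDiv X x ∂(surfMeas d) = - ∫ x, inner ℝ (G x) (X x.1) ∂(surfMeas d)

/-- `lam` is an eigenvalue of `-div (a ∇u) = lam a u` on the unit sphere, in the weak sense: there
is a nonzero `u` in `H¹` with `∫ a ⟨∇u, ∇v⟩ = lam ∫ a u v` for all `v` in `H¹`. -/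
def IsSphereEigenvalue {d : ℕ} (a : USphere d → ℝ) (lam : ℝ) : Prop :=
  ∃ (u : USphere d → ℝ) (G : USphere d → EuclideanSpace ℝ (Fin d)),
    IsH1WithGrad u G ∧ ¬ (u =ᵐ[surfMeas d] 0) ∧
    ∀ (v : USphere d → ℝ) (H : USphere d → EuclideanSpace ℝ (Fin d)), IsH1WithGrad v H →
      ∫ x, a x * inner ℝ (G x) (H x) ∂(surfMeas d) = lam * ∫ x, a x * (u x * v x) ∂(surfMeas d)

/-- The infimum of the Rayleigh quotients `∫ a |∇u|² / ∫ a u²` over the nonzero `u` in `H¹` with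
`∫ a u = 0`. -/
def rayleighInf {d : ℕ} (a : USphere d → ℝ) : ℝ :=
  sInf {r : ℝ | ∃ (u : USphere d → ℝ) (G : USphere d → EuclideanSpace ℝ (Fin d)),
    IsH1WithGrad u G ∧ ¬ (u =ᵐ[surfMeas d] 0) ∧ ∫ x, a x * u x ∂(surfMeas d) = 0 ∧
    r = (∫ x, a x * ‖G x‖ ^ 2 ∂(surfMeas d)) / ∫ x, a x * u x ^ 2 ∂(surfMeas d)}

/-- The exponent `α(lam)`: the larger root of `α² + (n - 1) α - lam`. -/
def alphaExp (n : ℕ) (lam : ℝ) : ℝ :=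
  (-((n : ℝ) - 1) + Real.sqrt (((n : ℝ) - 1) ^ 2 + 4 * lam)) / 2

end

open MvPolynomial

/-! Write `d = n - 1`. Upper bound: each coordinate `xᵢ` has zero weighted mean, so it is admissible
in the Rayleigh quotient. Since `∑ xᵢ² = 1` and `∑ |∇xᵢ|² = d - 1` on the sphere, adding the `d`
test inequalities gives `λ₁ ∫ a ≤ (d - 1) ∫ a` (`rayleighInf_le`).

Equality makes every `xᵢ` a minimizer. Testing its Euler–Lagrange equation with the component `Xᵢ`
of a smooth tangent field and summing over `i` gives `∫ a div X = λ₁ ∫ a ⟨x, X⟩ = 0`. So `a` has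
weak gradient zero and is constant (`exists_ae_eq_const_of_rayleighInf_eq`). The converse is the
sharp Poincaré inequality (`IsH1WithGrad.poincare`).

Existence of `λ₁` is the direct method: since `ln a` is bounded the weighted forms are coercive, and
a compact embedding of `H¹` in `L²` produces a minimizer (`exists_minimizer_of_totallyBounded`).

Both Poincaré and compactness come from one spectral estimate, `sphereEig_mul_norm_sq_le`. The
spherical Laplacian acts on polynomials of degree at most `m`, is symmetric by the divergence
theorem, and is multiplication by `-m(m + d - 2)` modulo lower degree. Polynomials are dense in
`L²`, and projecting onto them does not increase the Dirichlet energy. -/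

/-! ### The divergence theorem on the sphere -/

theorem integral_fderiv_apply_eq_zero_of_hasCompactSupport {d : ℕ}
    {f : EuclideanSpace ℝ (Fin d) → ℝ} (hf : ContDiff ℝ 1 f) (hc : HasCompactSupport f)
    (v : EuclideanSpace ℝ (Fin d)) : ∫ x, fderiv ℝ f x v = 0 := by
  have hint : Integrable (fun x => fderiv ℝ f x v) :=
    ((hf.continuous_fderiv one_ne_zero).clm_apply continuous_const).integrable_of_hasCompactSupport
      (hc.fderiv_apply (𝕜 := ℝ) v)
  have h := integral_mul_fderiv_eq_neg_fderiv_mul_of_integrable (μ := volume) (f := f)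
    (g := fun _ : EuclideanSpace ℝ (Fin d) => (1 : ℝ)) (v := v)
    (by simpa using hint) (by simp)
    (by simpa using hf.continuous.integrable_of_hasCompactSupport hc)
    (fun x _ => hf.differentiable one_ne_zero x) (fun x _ => differentiableAt_const _)
  simpa using h

instance isFiniteMeasure_surfMeas (d : ℕ) : IsFiniteMeasure (surfMeas d) :=
  inferInstanceAs (IsFiniteMeasure (Measure.toSphere _))

instance isOpenPosMeasure_surfMeas (d : ℕ) : (surfMeas d).IsOpenPosMeasure :=
  inferInstanceAs (Measure.IsOpenPosMeasure (Measure.toSphere _))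

/-- Polar coordinates; the Jacobian `r ^ (d - 1)` is contained in `volumeIoiPow`. No integrability
is needed, because the product formula for integrals holds unconditionally. -/
theorem integral_eq_mul_of_polar {d : ℕ} [NeZero d] {f : EuclideanSpace ℝ (Fin d) → ℝ}
    {A : USphere d → ℝ} {h : ℝ → ℝ}
    (hf : ∀ (x : USphere d) (r : ℝ), 0 < r → f (r • x.1) = A x * h r) :
    ∫ x, f x = (∫ x, A x ∂surfMeas d) * ∫ r, h r.1 ∂(Measure.volumeIoiPow (d - 1)) := by
  calc
    ∫ x, f x = ∫ x : ({(0)}ᶜ : Set (EuclideanSpace ℝ (Fin d))), f x.1 ∂(volume.comap Subtype.val) := by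
      rw [integral_subtype_comap (measurableSet_singleton _).compl f,
        restrict_compl_singleton]
    _ = ∫ p, A p.1 * h p.2.1 ∂(surfMeas d).prod (.volumeIoiPow (d - 1)) := by
      have := (volume : Measure (EuclideanSpace ℝ (Fin d))).measurePreserving_homeomorphUnitSphereProd.integral_comp
        (Homeomorph.measurableEmbedding _) (fun p => A p.1 * h p.2.1)
      simp only [finrank_euclideanSpace, Fintype.card_fin] at this
      unfold surfMeas
      rw [← this]
      refine integral_congr_ae (.of_forall fun x => ?_)
      have hx : (0 : ℝ) < ‖x.1‖ := norm_pos_iff.2 x.2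
      simp only
      rw [← hf _ _ (homeomorphUnitSphereProd _ x).2.2]
      simp [smul_smul, mul_inv_cancel₀ hx.ne']
    _ = _ := integral_prod_mul A (fun r : Set.Ioi (0 : ℝ) => h r.1)

/-- A smooth radial cut-off, vanishing near the origin and outside a ball. -/
noncomputable def radialBump : ContDiffBump (2 : ℝ) := ⟨1 / 2, 1, by norm_num, by norm_num⟩

theorem radialBump_eq_zero {r : ℝ} (hr : r ≤ 1 ∨ 3 ≤ r) : radialBump r = 0 := by
  apply radialBump.zero_of_le_dist
  rw [Real.dist_eq]
  change 1 ≤ _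
  rcases hr with h | h
  · rw [abs_of_nonpos] <;> linarith
  · rw [abs_of_nonneg] <;> linarith

theorem contDiffAt_norm_inv_smul {d : ℕ} {x : EuclideanSpace ℝ (Fin d)} (hx : x ≠ 0) :
    ContDiffAt ℝ ∞ (fun y : EuclideanSpace ℝ (Fin d) => ‖y‖⁻¹ • y) x :=
  ((contDiffAt_norm ℝ hx).inv (norm_ne_zero_iff.2 hx)).smul contDiffAt_id

/-- The extension of a function on the sphere by degree-zero homogeneity, cut off radially. -/
noncomputable def radialExtension {d : ℕ} {F : Type*} [AddCommGroup F] [Module ℝ F]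
    (f : EuclideanSpace ℝ (Fin d) → F) (x : EuclideanSpace ℝ (Fin d)) : F :=
  radialBump ‖x‖ • f (‖x‖⁻¹ • x)

theorem radialExtension_eq_zero {d : ℕ} {F : Type*} [AddCommGroup F] [Module ℝ F]
    (f : EuclideanSpace ℝ (Fin d) → F) {x : EuclideanSpace ℝ (Fin d)}
    (hx : ‖x‖ ≤ 1 ∨ 3 ≤ ‖x‖) : radialExtension f x = 0 := by
  simp [radialExtension, radialBump_eq_zero hx]

theorem hasCompactSupport_radialExtension {d : ℕ} {F : Type*} [AddCommGroup F] [Module ℝ F]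
    (f : EuclideanSpace ℝ (Fin d) → F) : HasCompactSupport (radialExtension f) :=
  HasCompactSupport.intro (isCompact_closedBall 0 3) fun x hx =>
    radialExtension_eq_zero f (.inr (by simpa using (not_le.1 (by simpa using hx)).le))

theorem contDiff_radialExtension {d : ℕ} {F : Type*} [NormedAddCommGroup F] [NormedSpace ℝ F]
    {f : EuclideanSpace ℝ (Fin d) → F} (hf : ContDiff ℝ ∞ f) :
    ContDiff ℝ ∞ (radialExtension f) := by
  rw [contDiff_iff_contDiffAt]
  intro x
  by_cases hx : x = 0
  · have : radialExtension f =ᶠ[nhds x] fun _ => 0 := by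
      filter_upwards [Metric.ball_mem_nhds x one_pos] with y hy
      subst hx
      exact radialExtension_eq_zero f (.inl (mem_ball_zero_iff.1 hy).le)
    exact contDiffAt_const.congr_of_eventuallyEq this
  · have h1 : ContDiffAt ℝ ∞ (fun y : EuclideanSpace ℝ (Fin d) => radialBump ‖y‖) x :=
      radialBump.contDiff.contDiffAt.comp x (contDiffAt_norm ℝ hx)
    exact h1.smul (hf.contDiffAt.comp x (contDiffAt_norm_inv_smul hx))

theorem norm_smul_sphere {d : ℕ} (x : USphere d) {r : ℝ} (hr : 0 < r) : ‖r • x.1‖ = r := by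
  rw [norm_smul, norm_eq_of_mem_sphere x, Real.norm_of_nonneg hr.le, mul_one]

theorem hasFDerivAt_norm_smul {d : ℕ} (x : USphere d) {r : ℝ} (hr : 0 < r) :
    HasFDerivAt (fun y : EuclideanSpace ℝ (Fin d) => ‖y‖) (innerSL ℝ x.1) (r • x.1) := by
  have hnr := norm_smul_sphere x hr
  have h2 := (hasStrictFDerivAt_norm_sq (r • x.1)).hasFDerivAt.sqrt (by rw [hnr]; positivity)
  simp only [Real.sqrt_sq (norm_nonneg _)] at h2
  convert! h2 using 1
  ext v
  rw [hnr]
  simp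
  field_simp

theorem hasFDerivAt_norm_inv_smul {d : ℕ} (x : USphere d) {r : ℝ} (hr : 0 < r) :
    HasFDerivAt (fun y : EuclideanSpace ℝ (Fin d) => ‖y‖⁻¹ • y)
      (r⁻¹ • (ContinuousLinearMap.id ℝ _ - (innerSL ℝ x.1).smulRight x.1)) (r • x.1) := by
  have hnr := norm_smul_sphere x hr
  have hrx : r • x.1 ≠ 0 := norm_pos_iff.1 (by rw [hnr]; exact hr)
  have h0 := hasFDerivAt_norm_smul x hr
  have h1 := (hasDerivAt_inv (norm_ne_zero_iff.2 hrx)).comp_hasFDerivAt _ h0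
  have h2 := h1.smul (hasFDerivAt_id (r • x.1))
  convert! h2 using 1
  ext v i
  simp only [Function.comp, hnr]
  simp
  field_simp
  ring

/-- The constant `c` is the derivative of the cut-off. Its value is irrelevant: it multiplies `X x`,
and for tangent `X` this rank-one term has trace zero. -/
theorem hasFDerivAt_radialExtension {d : ℕ}
    {X : EuclideanSpace ℝ (Fin d) → EuclideanSpace ℝ (Fin d)} (hX : ContDiff ℝ ∞ X)
    (x : USphere d) {r : ℝ} (hr : 0 < r) :
    ∃ c : ℝ, ∀ v, fderiv ℝ (radialExtension X) (r • x.1) v =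
      (c * inner ℝ x.1 v) • X x.1 +
        (radialBump r * r⁻¹) • (fderiv ℝ X x.1 v - inner ℝ x.1 v • fderiv ℝ X x.1 x.1) := by
  have hnr := norm_smul_sphere x hr
  have hpt : ‖r • x.1‖⁻¹ • (r • x.1) = x.1 := by
    rw [hnr, smul_smul, inv_mul_cancel₀ hr.ne', one_smul]
  have h0 := hasFDerivAt_norm_smul x hr
  have hb : HasDerivAt radialBump (deriv radialBump r) ‖r • x.1‖ := by
    rw [hnr]
    exact (radialBump.contDiff.differentiable one_ne_zero r).hasDerivAt
  have h1 := hb.comp_hasFDerivAt _ h0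
  have h2 : HasFDerivAt X (fderiv ℝ X x.1) (‖r • x.1‖⁻¹ • (r • x.1)) := by
    rw [hpt]; exact (hX.differentiable (by simp) x.1).hasFDerivAt
  have h3 := h1.smul (HasFDerivAt.comp (f := fun y : EuclideanSpace ℝ (Fin d) => ‖y‖⁻¹ • y) (r • x.1)
    h2 (hasFDerivAt_norm_inv_smul x hr))
  refine ⟨deriv radialBump r, fun v => ?_⟩
  have h4 : fderiv ℝ (radialExtension X) (r • x.1) = _ := h3.fderiv
  rw [h4]
  have hpt' : r⁻¹ • r • x.1 = x.1 := by rw [smul_smul, inv_mul_cancel₀ hr.ne', one_smul]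
  simp only [Function.comp, hnr, hpt']
  simp
  module

/-- The Euclidean divergence of the extended field separates into an angular and a radial factor, so
the divergence theorem on `ℝ^d` descends to the sphere. The factor `r⁻¹` comes from differentiating
a function homogeneous of degree zero. -/
theorem sum_fderiv_radialExtension {d : ℕ}
    {X : EuclideanSpace ℝ (Fin d) → EuclideanSpace ℝ (Fin d)} (hX : IsSmoothTangentField X)
    (x : USphere d) {r : ℝ} (hr : 0 < r) :
    ∑ i, (fderiv ℝ (radialExtension X) (r • x.1) (EuclideanSpace.single i 1)) i =
      sphereDiv X x * (radialBump r * r⁻¹) := by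
  obtain ⟨c, hc⟩ := hasFDerivAt_radialExtension hX.1 x hr
  have ht := hX.2 x
  simp only [hc, sphereDiv]
  simp only [PiLp.inner_apply, RCLike.inner_apply, conj_trivial] at ht ⊢
  simp only [PiLp.add_apply, PiLp.smul_apply, PiLp.sub_apply, smul_eq_mul,
    PiLp.single_apply, ite_mul, one_mul, zero_mul, Finset.sum_ite_eq',
    Finset.mem_univ, if_true, Finset.sum_add_distrib, ← Finset.mul_sum, Finset.sum_sub_distrib]
  have : ∑ i, c * x.1 i * (X x.1) i = 0 := by
    simp_rw [mul_assoc, ← Finset.mul_sum, ht, mul_zero]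
  rw [this]
  ring

/-- Allows the radial factor to be cancelled. The total surface measure appears because the product
is, by polar coordinates, the integral of a nonnegative nonzero function on `ℝ^d`. -/
theorem integral_radialBump_pos {d : ℕ} [NeZero d] :
    0 < (surfMeas d).real Set.univ *
      ∫ r, radialBump r.1 * r.1⁻¹ ∂(Measure.volumeIoiPow (d - 1)) := by
  have hsm : (surfMeas d).real Set.univ = ∫ _x : USphere d, (1 : ℝ) ∂surfMeas d := by simp
  rw [hsm, ← integral_eq_mul_of_polar (A := fun _ : USphere d => (1 : ℝ))
    (h := fun r => radialBump r * r⁻¹) (f := fun x => radialBump ‖x‖ * ‖x‖⁻¹)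
    (fun x r hr => by rw [norm_smul_sphere x hr, one_mul])]
  have hcont : Continuous fun x : EuclideanSpace ℝ (Fin d) => radialBump ‖x‖ * ‖x‖⁻¹ := by
    rw [continuous_iff_continuousAt]
    intro x
    by_cases hx : x = 0
    · have : (fun x : EuclideanSpace ℝ (Fin d) => radialBump ‖x‖ * ‖x‖⁻¹) =ᶠ[nhds x]
          fun _ => 0 := by
        filter_upwards [Metric.ball_mem_nhds x one_pos] with y hy
        subst hx
        rw [radialBump_eq_zero (.inl (mem_ball_zero_iff.1 hy).le), zero_mul]
      exact continuousAt_const.congr this.symm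
    · exact (radialBump.continuous.comp continuous_norm).continuousAt.mul
        (continuous_norm.continuousAt.inv₀ (norm_ne_zero_iff.2 hx))
  obtain ⟨x⟩ : Nonempty (USphere d) :=
    ⟨⟨EuclideanSpace.single 0 1, by simp⟩⟩
  refine hcont.integral_pos_of_hasCompactSupport_nonneg_nonzero (x := (2 : ℝ) • x.1) ?_
    (fun y => mul_nonneg radialBump.nonneg (by positivity)) ?_
  · exact HasCompactSupport.intro (isCompact_closedBall 0 3) fun y hy => by
      rw [radialBump_eq_zero (.inr (by simpa using (not_le.1 (by simpa using hy)).le)), zero_mul]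
  · rw [norm_smul_sphere x two_pos]
    have : radialBump 2 = 1 := radialBump.one_of_mem_closedBall
      (Metric.mem_closedBall_self radialBump.rIn_pos.le)
    rw [this]
    norm_num

theorem fderiv_apply_coord {d : ℕ} {Y : EuclideanSpace ℝ (Fin d) → EuclideanSpace ℝ (Fin d)}
    (hY : Differentiable ℝ Y) (x v : EuclideanSpace ℝ (Fin d)) (i : Fin d) :
    (fderiv ℝ Y x v) i = fderiv ℝ (fun z => Y z i) x v := by
  have h : HasFDerivAt (fun z => Y z i)
      ((EuclideanSpace.proj i : EuclideanSpace ℝ (Fin d) →L[ℝ] ℝ).comp (fderiv ℝ Y x)) x :=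
    (EuclideanSpace.proj i : EuclideanSpace ℝ (Fin d) →L[ℝ] ℝ).hasFDerivAt.comp x (hY x).hasFDerivAt
  rw [h.fderiv]
  rfl

/-- The divergence theorem on the unit sphere. -/
theorem integral_sphereDiv_eq_zero {d : ℕ} [NeZero d]
    {X : EuclideanSpace ℝ (Fin d) → EuclideanSpace ℝ (Fin d)} (hX : IsSmoothTangentField X) :
    ∫ x, sphereDiv X x ∂surfMeas d = 0 := by
  have h1 : ∫ y, ∑ i, (fderiv ℝ (radialExtension X) y (EuclideanSpace.single i 1)) i = 0 := by
    have hY := contDiff_radialExtension hX.1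
    have hc : ∀ i, ContDiff ℝ ∞ (fun z => radialExtension X z i) := fun i =>
      (EuclideanSpace.proj (𝕜 := ℝ) i).contDiff.comp hY
    have hs : ∀ i, HasCompactSupport (fun z => radialExtension X z i) := fun i =>
      (hasCompactSupport_radialExtension X).comp_left (g := fun v : EuclideanSpace ℝ (Fin d) => v i) rfl
    simp_rw [fderiv_apply_coord (hY.differentiable (by simp))]
    rw [integral_finsetSum]
    · exact Finset.sum_eq_zero fun i _ => integral_fderiv_apply_eq_zero_of_hasCompactSupport
        ((hc i).of_le (by simp)) (hs i) _
    · intro i _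
      exact (((hc i).continuous_fderiv (by simp)).clm_apply
        continuous_const).integrable_of_hasCompactSupport ((hs i).fderiv_apply (𝕜 := ℝ) _)
  rw [integral_eq_mul_of_polar (A := sphereDiv X) (h := fun r => radialBump r * r⁻¹)
    (fun x r hr => sum_fderiv_radialExtension hX x hr)] at h1
  exact (mul_eq_zero.1 h1).resolve_right (right_ne_zero_of_mul integral_radialBump_pos.ne')

/-! ### Smooth functions as elements of `H¹` -/

theorem continuous_sphereDiv {d : ℕ} {X : EuclideanSpace ℝ (Fin d) → EuclideanSpace ℝ (Fin d)}
    (hX : ContDiff ℝ ∞ X) : Continuous (sphereDiv X) := by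
  have h : Continuous (fun x : USphere d => fderiv ℝ X x.1) :=
    (hX.continuous_fderiv (by simp)).comp continuous_subtype_val
  unfold sphereDiv
  refine (continuous_finsetSum _ fun i _ => ?_).sub
    ((h.clm_apply continuous_subtype_val).inner continuous_subtype_val)
  exact (EuclideanSpace.proj (𝕜 := ℝ) i).continuous.comp (h.clm_apply continuous_const)

theorem memLp_of_continuous_sphere {d : ℕ} {F : Type*} [NormedAddCommGroup F]
    [SecondCountableTopology F] {f : USphere d → F} (hf : Continuous f)
    (p : ENNReal) : MemLp f p (surfMeas d) := by
  obtain ⟨C, hC⟩ := isCompact_univ.exists_bound_of_continuousOn hf.continuousOn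
  exact MemLp.of_bound hf.aestronglyMeasurable C (.of_forall fun x => hC x trivial)

theorem integrable_of_continuous_sphere {d : ℕ} {f : USphere d → ℝ} (hf : Continuous f) :
    Integrable f (surfMeas d) :=
  memLp_one_iff_integrable.1 (memLp_of_continuous_sphere hf 1)

/-- The gradient of `f`, with its component in the direction of the position vector removed. -/
noncomputable def tgrad {d : ℕ} (f : EuclideanSpace ℝ (Fin d) → ℝ)
    (x : EuclideanSpace ℝ (Fin d)) : EuclideanSpace ℝ (Fin d) :=
  gradient f x - inner ℝ (gradient f x) x • x

theorem gradient_apply {d : ℕ} (f : EuclideanSpace ℝ (Fin d) → ℝ)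
    (x : EuclideanSpace ℝ (Fin d)) (i : Fin d) :
    gradient f x i = fderiv ℝ f x (EuclideanSpace.single i 1) := by
  rw [← inner_gradient_left]
  rw [EuclideanSpace.inner_single_right]
  simp

theorem inner_tgrad_of_inner_eq_zero {d : ℕ} (f : EuclideanSpace ℝ (Fin d) → ℝ)
    {x v : EuclideanSpace ℝ (Fin d)} (h : inner ℝ v x = 0) :
    inner ℝ (tgrad f x) v = fderiv ℝ f x v := by
  rw [tgrad, inner_sub_left, inner_smul_left, real_inner_comm v x, h,
    inner_gradient_left]
  simp

theorem contDiff_tgrad {d : ℕ} {f : EuclideanSpace ℝ (Fin d) → ℝ} (hf : ContDiff ℝ ∞ f) :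
    ContDiff ℝ ∞ (tgrad f) := by
  have h : ContDiff ℝ ∞ (gradient f) :=
    (InnerProductSpace.toDual ℝ (EuclideanSpace ℝ (Fin d))).symm.contDiff.comp
      (hf.fderiv_right (by simp))
  exact h.sub ((h.inner ℝ contDiff_id).smul contDiff_id)

theorem isSmoothTangentField_tgrad {d : ℕ} {f : EuclideanSpace ℝ (Fin d) → ℝ}
    (hf : ContDiff ℝ ∞ f) : IsSmoothTangentField (tgrad f) := by
  refine ⟨contDiff_tgrad hf, fun x => ?_⟩
  simp only [tgrad]
  rw [inner_sub_left, inner_smul_left, real_inner_self_eq_norm_sq, norm_eq_of_mem_sphere x]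
  simp

theorem sphereDiv_smul {d : ℕ} {f : EuclideanSpace ℝ (Fin d) → ℝ}
    {X : EuclideanSpace ℝ (Fin d) → EuclideanSpace ℝ (Fin d)}
    (hf : ContDiff ℝ ∞ f) (hX : IsSmoothTangentField X) (x : USphere d) :
    sphereDiv (fun y => f y • X y) x =
      f x.1 * sphereDiv X x + inner ℝ (tgrad f x.1) (X x.1) := by
  rw [inner_tgrad_of_inner_eq_zero f (hX.2 x)]
  have h := ((hf.differentiable (by simp) x.1).hasFDerivAt.smul
    (hX.1.differentiable (by simp) x.1).hasFDerivAt).fderiv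
  have h' : fderiv ℝ (fun y => f y • X y) x.1 = _ := h
  have hv : fderiv ℝ f x.1 (X x.1) =
      ∑ i, fderiv ℝ f x.1 (EuclideanSpace.single i 1) * X x.1 i := by
    rw [← inner_gradient_left, PiLp.inner_apply]
    exact Finset.sum_congr rfl fun i _ => by
      rw [gradient_apply]; simp [mul_comm]
  unfold sphereDiv
  rw [h', hv]
  simp only [add_apply, smul_apply,
    ContinuousLinearMap.smulRight_apply, PiLp.add_apply, PiLp.smul_apply, smul_eq_mul,
    Finset.sum_add_distrib, ← Finset.mul_sum, inner_add_left, real_inner_smul_left, hX.2 x]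
  ring

/-- The weak gradient identity is the divergence theorem for the tangent field `f X`. -/
theorem isH1WithGrad_of_contDiff {d : ℕ} [NeZero d] {f : EuclideanSpace ℝ (Fin d) → ℝ}
    (hf : ContDiff ℝ ∞ f) : IsH1WithGrad (fun x : USphere d => f x.1) (fun x => tgrad f x.1) where
  memLp_fun := memLp_of_continuous_sphere (hf.continuous.comp continuous_subtype_val) 2
  memLp_grad := memLp_of_continuous_sphere
    ((contDiff_tgrad hf).continuous.comp continuous_subtype_val) 2
  tangent := .of_forall (isSmoothTangentField_tgrad hf).2
  integral_div X hX := by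
    have hfX : IsSmoothTangentField fun y => f y • X y :=
      ⟨hf.smul hX.1, fun x => by rw [real_inner_smul_left, hX.2 x, mul_zero]⟩
    have h := integral_sphereDiv_eq_zero hfX
    simp_rw [sphereDiv_smul hf hX] at h
    rw [integral_add] at h
    · linarith
    · exact integrable_of_continuous_sphere
        ((hf.continuous.comp continuous_subtype_val).mul (continuous_sphereDiv hX.1))
    · exact integrable_of_continuous_sphere
        (((contDiff_tgrad hf).continuous.comp continuous_subtype_val).inner
          (hX.1.continuous.comp continuous_subtype_val))


/-! ### The spherical Laplacian on polynomials -/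

/-- Evaluation of a polynomial in the coordinates of Euclidean space. -/
noncomputable def pev {d : ℕ} (p : MvPolynomial (Fin d) ℝ) (x : EuclideanSpace ℝ (Fin d)) : ℝ :=
  eval x.ofLp p

theorem contDiff_pev {d : ℕ} (p : MvPolynomial (Fin d) ℝ) : ContDiff ℝ ∞ (pev p) := by
  induction p using MvPolynomial.induction_on with
  | C r =>
    have : pev (C r : MvPolynomial (Fin d) ℝ) = fun _ => r := by ext; simp [pev]
    rw [this]; exact contDiff_const
  | add p q hp hq =>
    have : pev (p + q) = fun x => pev p x + pev q x := by ext; simp [pev]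
    rw [this]; exact hp.add hq
  | mul_X p i hp =>
    have : pev (p * X i) =
        fun x => pev p x * (EuclideanSpace.proj i : EuclideanSpace ℝ (Fin d) →L[ℝ] ℝ) x := by
      ext; simp [pev]
    rw [this]; exact hp.mul (ContinuousLinearMap.contDiff _)

theorem hasFDerivAt_pev {d : ℕ} (p : MvPolynomial (Fin d) ℝ) (x : EuclideanSpace ℝ (Fin d)) :
    HasFDerivAt (pev p)
      (∑ i, pev (pderiv i p) x • (EuclideanSpace.proj i : EuclideanSpace ℝ (Fin d) →L[ℝ] ℝ)) x := by
  induction p using MvPolynomial.induction_on with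
  | C r =>
    have : pev (C r : MvPolynomial (Fin d) ℝ) = fun _ => r := by ext; simp [pev]
    rw [this]
    convert! hasFDerivAt_const (𝕜 := ℝ) r x using 1
    ext; simp [pev]
  | add p q hp hq =>
    have := hp.add hq
    convert! this using 1
    · ext; simp [pev]
    · ext; simp [pev, add_mul, Finset.sum_add_distrib]
  | mul_X p j hp =>
    have := hp.mul (EuclideanSpace.proj j : EuclideanSpace ℝ (Fin d) →L[ℝ] ℝ).hasFDerivAt
    convert! this using 1
    · ext; simp [pev]
    · ext v
      simp only [pev, Derivation.leibniz, pderiv_X]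
      simp [add_mul, Finset.sum_add_distrib, Pi.single_apply, Finset.mul_sum, mul_assoc, ite_mul,
        apply_ite]

theorem fderiv_pev_apply {d : ℕ} (p : MvPolynomial (Fin d) ℝ) (x v : EuclideanSpace ℝ (Fin d)) :
    fderiv ℝ (pev p) x v = ∑ i, pev (pderiv i p) x * v i := by
  rw [(hasFDerivAt_pev p x).fderiv]; simp

/-- The Euler operator `∑ xᵢ ∂ᵢ` on polynomials. -/
noncomputable def eulerOp (d : ℕ) :
    Derivation ℝ (MvPolynomial (Fin d) ℝ) (MvPolynomial (Fin d) ℝ) :=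
  ∑ i, (X i : MvPolynomial (Fin d) ℝ) • pderiv i

theorem eulerOp_apply {d : ℕ} (p : MvPolynomial (Fin d) ℝ) :
    eulerOp d p = ∑ i, X i * pderiv i p := by
  change Derivation.coeFnAddMonoidHom (eulerOp d) p = _
  rw [eulerOp, map_sum, Finset.sum_apply]
  rfl

theorem eulerOp_X {d : ℕ} (i : Fin d) : eulerOp d (X i) = X i := by
  simp [eulerOp_apply, pderiv_X, Pi.single_apply]

theorem sum_X_mul_eulerOp_pderiv {d : ℕ} (p : MvPolynomial (Fin d) ℝ) :
    ∑ i, X i * eulerOp d (pderiv i p) = eulerOp d (eulerOp d p) - eulerOp d p := by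
  conv_rhs => rw [eulerOp_apply p, map_sum]
  simp only [Derivation.leibniz, eulerOp_X, smul_eq_mul, Finset.sum_add_distrib]
  simp [mul_comm]

/-- A polynomial representing the Laplacian on the sphere of the restriction of a polynomial. -/
noncomputable def sphereLap (d : ℕ) : MvPolynomial (Fin d) ℝ →ₗ[ℝ] MvPolynomial (Fin d) ℝ :=
  ∑ i, ((pderiv i : Derivation ℝ (MvPolynomial (Fin d) ℝ) (MvPolynomial (Fin d) ℝ)) :
      MvPolynomial (Fin d) ℝ →ₗ[ℝ] MvPolynomial (Fin d) ℝ) ∘ₗ (pderiv i).toLinearMap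
    - (eulerOp d).toLinearMap ∘ₗ (eulerOp d).toLinearMap - ((d : ℝ) - 2) • (eulerOp d).toLinearMap

theorem sphereLap_apply {d : ℕ} (p : MvPolynomial (Fin d) ℝ) :
    sphereLap d p = ∑ i, pderiv i (pderiv i p) - eulerOp d (eulerOp d p)
      - ((d : ℝ) - 2) • eulerOp d p := by
  simp [sphereLap]

theorem tgrad_pev_apply {d : ℕ} (p : MvPolynomial (Fin d) ℝ) (x : EuclideanSpace ℝ (Fin d))
    (i : Fin d) : tgrad (pev p) x i = pev (pderiv i p - X i * eulerOp d p) x := by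
  have h : pev (eulerOp d p) x = inner ℝ (gradient (pev p) x) x := by
    rw [inner_gradient_left, fderiv_pev_apply, eulerOp_apply]
    simp [pev, mul_comm]
  have h2 : pev (pderiv i p - X i * eulerOp d p) x =
      pev (pderiv i p) x - x i * pev (eulerOp d p) x := by simp [pev]
  rw [h2, h, tgrad, PiLp.sub_apply, gradient_apply, fderiv_pev_apply]
  simp [PiLp.single_apply, mul_comm]

theorem sum_pderiv_tangential {d : ℕ} (p : MvPolynomial (Fin d) ℝ) :
    ∑ i, pderiv i (pderiv i p - X i * eulerOp d p) =
      ∑ i, pderiv i (pderiv i p) - eulerOp d (eulerOp d p) - (d : ℝ) • eulerOp d p := by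
  rw [eulerOp_apply (eulerOp d p)]
  generalize eulerOp d p = q
  simp only [map_sub, Derivation.leibniz, pderiv_X_self, smul_eq_mul, mul_one,
    Finset.sum_sub_distrib, Finset.sum_add_distrib, Finset.sum_const, Finset.card_univ,
    Fintype.card_fin, ← Nat.cast_smul_eq_nsmul ℝ, sub_sub]

theorem sum_X_mul_eulerOp_tangential {d : ℕ} (p : MvPolynomial (Fin d) ℝ) :
    ∑ i, X i * eulerOp d (pderiv i p - X i * eulerOp d p) =
      eulerOp d (eulerOp d p) - eulerOp d p
        - (∑ i, X i * X i) * (eulerOp d p + eulerOp d (eulerOp d p)) := by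
  rw [← sum_X_mul_eulerOp_pderiv, Finset.sum_mul, ← Finset.sum_sub_distrib]
  refine Finset.sum_congr rfl fun i _ => ?_
  rw [map_sub, Derivation.leibniz, eulerOp_X, smul_eq_mul, smul_eq_mul]
  ring

/-- The divergence of the tangential gradient, computed as a polynomial, differs from `sphereLap d
p` by a multiple of `|x|² - 1`, which vanishes on the sphere. -/
theorem sphereDiv_tgrad_pev {d : ℕ} (p : MvPolynomial (Fin d) ℝ) (x : USphere d) :
    sphereDiv (tgrad (pev p)) x = pev (sphereLap d p) x.1 := by
  have hd : ∀ (v : EuclideanSpace ℝ (Fin d)) i, (fderiv ℝ (tgrad (pev p)) x.1 v) i =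
      ∑ j, pev (pderiv j (pderiv i p - X i * eulerOp d p)) x.1 * v j := by
    intro v i
    rw [fderiv_apply_coord ((contDiff_tgrad (contDiff_pev p)).differentiable (by simp)),
      ← fderiv_pev_apply]
    simp_rw [tgrad_pev_apply]
  have hx : ∑ i, x.1 i * x.1 i = 1 := by
    have := real_inner_self_eq_norm_sq x.1
    rw [norm_eq_of_mem_sphere x, PiLp.inner_apply] at this
    simpa [pow_two] using this
  have h1 : sphereDiv (tgrad (pev p)) x = pev (∑ i, pderiv i (pderiv i p - X i * eulerOp d p)
      - ∑ i, X i * eulerOp d (pderiv i p - X i * eulerOp d p)) x.1 := by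
    unfold sphereDiv
    rw [PiLp.inner_apply]
    simp only [hd, eulerOp_apply (pderiv _ _ - _)]
    simp [pev, PiLp.single_apply, Finset.mul_sum, mul_comm]
  have h2 : ∑ i, pderiv i (pderiv i p - X i * eulerOp d p)
      - ∑ i, X i * eulerOp d (pderiv i p - X i * eulerOp d p) =
      sphereLap d p + (∑ i, X i * X i - 1) * (eulerOp d p + eulerOp d (eulerOp d p)) := by
    rw [sum_pderiv_tangential, sum_X_mul_eulerOp_tangential, sphereLap_apply, sub_smul,
      ofNat_smul_eq_nsmul ℝ 2, two_smul]
    ring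
  rw [h1, h2]
  simp [pev, hx]

/-- The eigenvalue `k (k + d - 2)` of the Laplacian on the unit sphere of `ℝ^d`. -/
noncomputable def sphereEig (d k : ℕ) : ℝ := k * (k + d - 2)

theorem MvPolynomial.IsHomogeneous.mem_restrictTotalDegree_of_le {σ : Type*}
    {p : MvPolynomial σ ℝ} {k m : ℕ} (hp : p.IsHomogeneous k) (h : k ≤ m) :
    p ∈ restrictTotalDegree σ ℝ m :=
  (mem_restrictTotalDegree _ _ _).2 (hp.totalDegree_le.trans h)

/-- By Euler's identity `eulerOp` is multiplication by `k` in degree `k`, so `sphereLap` is the flat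
Laplacian minus `k² + (d - 2) k`. The flat Laplacian lowers the degree by two. -/
theorem sphereLap_add_smul_of_isHomogeneous {d k : ℕ} {p : MvPolynomial (Fin d) ℝ}
    (hp : p.IsHomogeneous k) :
    sphereLap d p + sphereEig d k • p = ∑ i, pderiv i (pderiv i p) := by
  have h : eulerOp d p = (k : ℝ) • p := by
    rw [eulerOp_apply, hp.sum_X_mul_pderiv, Nat.cast_smul_eq_nsmul]
  rw [sphereLap_apply, h, Derivation.map_smul, h, sphereEig]
  module

theorem sum_pderiv_pderiv_mem {d k m : ℕ} {p : MvPolynomial (Fin d) ℝ}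
    (hp : p.IsHomogeneous k) (h : k ≤ m + 1) :
    ∑ i, pderiv i (pderiv i p) ∈ restrictTotalDegree (Fin d) ℝ m :=
  Submodule.sum_mem _ fun _ _ => hp.pderiv.pderiv.mem_restrictTotalDegree_of_le (by omega)

theorem induction_homogeneous_of_mem_restrictTotalDegree {d m : ℕ}
    {p : MvPolynomial (Fin d) ℝ} (hp : p ∈ restrictTotalDegree (Fin d) ℝ m)
    {S : Submodule ℝ (MvPolynomial (Fin d) ℝ)}
    (h : ∀ k ≤ m, ∀ q : MvPolynomial (Fin d) ℝ, q.IsHomogeneous k → q ∈ S) : p ∈ S := by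
  rw [← sum_homogeneousComponent p]
  rw [mem_restrictTotalDegree] at hp
  exact Submodule.sum_mem _ fun k hk => h k (by rw [Finset.mem_range] at hk; omega) _
    (homogeneousComponent_isHomogeneous k p)

theorem sphereLap_mem {d m : ℕ} {p : MvPolynomial (Fin d) ℝ}
    (hp : p ∈ restrictTotalDegree (Fin d) ℝ m) :
    sphereLap d p ∈ restrictTotalDegree (Fin d) ℝ m := by
  refine induction_homogeneous_of_mem_restrictTotalDegree hp
    (S := (restrictTotalDegree (Fin d) ℝ m).comap (sphereLap d)) fun k hk q hq => ?_
  rw [Submodule.mem_comap, eq_sub_of_add_eq (sphereLap_add_smul_of_isHomogeneous hq)]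
  exact Submodule.sub_mem _ (sum_pderiv_pderiv_mem hq (by omega))
    (Submodule.smul_mem _ _ (hq.mem_restrictTotalDegree_of_le hk))

/-- The shift by the eigenvalue cancels the top homogeneous component; lower components stay in
degree at most `m`. -/
theorem sphereLap_add_smul_mem {d m : ℕ} {p : MvPolynomial (Fin d) ℝ}
    (hp : p ∈ restrictTotalDegree (Fin d) ℝ (m + 1)) :
    sphereLap d p + sphereEig d (m + 1) • p ∈ restrictTotalDegree (Fin d) ℝ m := by
  have hL : ∀ q, (sphereLap d + sphereEig d (m + 1) •
      (LinearMap.id : MvPolynomial (Fin d) ℝ →ₗ[ℝ] MvPolynomial (Fin d) ℝ)) q =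
      sphereLap d q + sphereEig d (m + 1) • q := fun q => by
    rw [LinearMap.add_apply, LinearMap.smul_apply, LinearMap.id_apply]
  rw [← hL, ← Submodule.mem_comap]
  refine induction_homogeneous_of_mem_restrictTotalDegree hp fun k hk q hq => ?_
  have : sphereLap d q + sphereEig d (m + 1) • q =
      ∑ i, pderiv i (pderiv i q) + (sphereEig d (m + 1) - sphereEig d k) • q := by
    rw [← sphereLap_add_smul_of_isHomogeneous hq]
    generalize sphereLap d q = r
    module
  rw [Submodule.mem_comap, hL, this]
  refine Submodule.add_mem _ (sum_pderiv_pderiv_mem hq hk) ?_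
  rcases hk.lt_or_eq with h | rfl
  · exact Submodule.smul_mem _ _ (hq.mem_restrictTotalDegree_of_le (by omega))
  · simp

theorem sphereEig_mono {d k m : ℕ} (hd : 1 ≤ d) (h : k ≤ m) :
    sphereEig d (k + 1) ≤ sphereEig d (m + 1) := by
  unfold sphereEig
  have h1 : (k : ℝ) ≤ m := by exact_mod_cast h
  have h2 : (1 : ℝ) ≤ d := by exact_mod_cast hd
  push_cast
  gcongr
  have : (0 : ℝ) ≤ k := k.cast_nonneg
  linarith

/-! ### Density of polynomials in `L²` -/

/-- Restriction of polynomials to the sphere. -/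
noncomputable def polyRestrict (d : ℕ) : MvPolynomial (Fin d) ℝ →ₐ[ℝ] C(USphere d, ℝ) :=
  aeval fun i => ⟨fun x => x.1 i,
    (EuclideanSpace.proj (𝕜 := ℝ) i).continuous.comp continuous_subtype_val⟩

theorem polyRestrict_apply {d : ℕ} (p : MvPolynomial (Fin d) ℝ) (x : USphere d) :
    polyRestrict d p x = pev p x.1 := by
  induction p using MvPolynomial.induction_on with
  | C r => simp [polyRestrict, pev]
  | add p q hp hq => rw [map_add, ContinuousMap.add_apply, hp, hq]; simp [pev]
  | mul_X p i hp =>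
    rw [map_mul, ContinuousMap.mul_apply, hp, polyRestrict, aeval_X]
    simp only [pev, map_mul, eval_X]; rfl

theorem denseRange_polyRestrict (d : ℕ) : DenseRange (polyRestrict d) := by
  have h : (polyRestrict d).range.SeparatesPoints := by
    intro x y hxy
    have : ∃ i, x.1 i ≠ y.1 i := by
      by_contra! h
      exact hxy (Subtype.ext (PiLp.ext h))
    obtain ⟨i, hi⟩ := this
    refine ⟨_, ⟨polyRestrict d (X i), ⟨X i, rfl⟩, rfl⟩, ?_⟩
    simpa [polyRestrict_apply, pev] using hi
  have := ContinuousMap.subalgebra_topologicalClosure_eq_top_of_separatesPoints _ h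
  have h2 := congrArg (fun A : Subalgebra ℝ C(USphere d, ℝ) => (A : Set C(USphere d, ℝ))) this
  simpa [DenseRange, dense_iff_closure_eq] using h2

/-- The square-integrable function on the sphere given by a polynomial. -/
noncomputable def polyLp (d : ℕ) : MvPolynomial (Fin d) ℝ →ₗ[ℝ] Lp ℝ 2 (surfMeas d) :=
  (ContinuousMap.toLp 2 (surfMeas d) ℝ).toLinearMap ∘ₗ (polyRestrict d).toLinearMap

theorem coeFn_polyLp {d : ℕ} (p : MvPolynomial (Fin d) ℝ) :
    polyLp d p =ᵐ[surfMeas d] fun x => pev p x.1 := by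
  filter_upwards [ContinuousMap.coeFn_toLp (p := 2) (𝕜 := ℝ) (surfMeas d) (polyRestrict d p)]
    with x hx
  rw [← polyRestrict_apply, ← hx]; rfl

theorem denseRange_polyLp (d : ℕ) : DenseRange (polyLp d) :=
  (ContinuousMap.toLp_denseRange ℝ (surfMeas d) ℝ (p := 2) (by simp)).comp
    (denseRange_polyRestrict d) (ContinuousMap.toLp 2 (surfMeas d) ℝ).continuous

/-! ### `H¹` as a closed subspace of `L² × L²` -/

theorem IsH1WithGrad.congr {d : ℕ} {u v : USphere d → ℝ} {G H : USphere d → EuclideanSpace ℝ (Fin d)}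
    (h : IsH1WithGrad u G) (huv : u =ᵐ[surfMeas d] v) (hGH : G =ᵐ[surfMeas d] H) :
    IsH1WithGrad v H where
  memLp_fun := h.memLp_fun.ae_eq huv
  memLp_grad := h.memLp_grad.ae_eq hGH
  tangent := by filter_upwards [h.tangent, hGH] with x hx h'; rw [← h', hx]
  integral_div X hX := by
    have e1 : ∫ x, v x * sphereDiv X x ∂surfMeas d = ∫ x, u x * sphereDiv X x ∂surfMeas d :=
      integral_congr_ae (huv.mono fun x hx => congrArg (· * sphereDiv X x) hx.symm)
    have e2 : ∫ x, inner ℝ (H x) (X x.1) ∂surfMeas d = ∫ x, inner ℝ (G x) (X x.1) ∂surfMeas d :=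
      integral_congr_ae (hGH.mono fun x hx => congrArg (inner ℝ · (X x.1)) hx.symm)
    rw [e1, e2, h.integral_div X hX]

theorem integrable_inner_of_memLp {d : ℕ} {F : Type*} [NormedAddCommGroup F]
    [InnerProductSpace ℝ F] {G H : USphere d → F}
    (hG : MemLp G 2 (surfMeas d)) (hH : MemLp H 2 (surfMeas d)) :
    Integrable (fun x => inner ℝ (G x) (H x)) (surfMeas d) := by
  refine (L2.integrable_inner (𝕜 := ℝ) (hG.toLp G) (hH.toLp H)).congr ?_
  filter_upwards [hG.coeFn_toLp, hH.coeFn_toLp] with x h1 h2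
  rw [h1, h2]

theorem IsSmoothTangentField.memLp {d : ℕ}
    {X : EuclideanSpace ℝ (Fin d) → EuclideanSpace ℝ (Fin d)} (hX : IsSmoothTangentField X) :
    MemLp (fun x : USphere d => X x.1) 2 (surfMeas d) :=
  memLp_of_continuous_sphere (hX.1.continuous.comp continuous_subtype_val) 2

theorem memLp_sphereDiv {d : ℕ}
    {X : EuclideanSpace ℝ (Fin d) → EuclideanSpace ℝ (Fin d)} (hX : IsSmoothTangentField X) :
    MemLp (sphereDiv X) 2 (surfMeas d) :=
  memLp_of_continuous_sphere (continuous_sphereDiv hX.1) 2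

/-- The Sobolev space `H¹` of the sphere as the graph of the weak gradient. -/
noncomputable def sphereH1 (d : ℕ) :
    Submodule ℝ (Lp ℝ 2 (surfMeas d) × Lp (EuclideanSpace ℝ (Fin d)) 2 (surfMeas d)) where
  carrier := {z | IsH1WithGrad z.1 z.2}
  zero_mem' := by
    have : IsH1WithGrad (d := d) 0 0 :=
      ⟨MemLp.zero, MemLp.zero, by simp, by simp⟩
    exact this.congr (Lp.coeFn_zero _ _ _).symm (Lp.coeFn_zero _ _ _).symm
  add_mem' := by
    intro y z hy hz
    have : IsH1WithGrad ((y.1 : USphere d → ℝ) + (z.1 : USphere d → ℝ))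
        ((y.2 : USphere d → EuclideanSpace ℝ (Fin d)) + (z.2 : USphere d → EuclideanSpace ℝ (Fin d))) := by
      refine ⟨hy.memLp_fun.add hz.memLp_fun, hy.memLp_grad.add hz.memLp_grad, ?_, ?_⟩
      · filter_upwards [hy.tangent, hz.tangent] with x h1 h2
        rw [Pi.add_apply, inner_add_left, h1, h2, add_zero]
      · intro X hX
        simp only [Pi.add_apply, add_mul, inner_add_left]
        rw [integral_add, integral_add, hy.integral_div X hX, hz.integral_div X hX]
        · ring
        · exact integrable_inner_of_memLp hy.memLp_grad hX.memLp
        · exact integrable_inner_of_memLp hz.memLp_grad hX.memLp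
        · exact hy.memLp_fun.integrable_mul (memLp_sphereDiv hX)
        · exact hz.memLp_fun.integrable_mul (memLp_sphereDiv hX)
    exact this.congr (Lp.coeFn_add _ _).symm (Lp.coeFn_add _ _).symm
  smul_mem' := by
    intro c z hz
    have : IsH1WithGrad (c • (z.1 : USphere d → ℝ))
        (c • (z.2 : USphere d → EuclideanSpace ℝ (Fin d))) := by
      refine ⟨hz.memLp_fun.const_smul c, hz.memLp_grad.const_smul c, ?_, ?_⟩
      · filter_upwards [hz.tangent] with x h
        rw [Pi.smul_apply, real_inner_smul_left, h, mul_zero]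
      · intro X hX
        simp only [Pi.smul_apply, smul_eq_mul, mul_assoc, real_inner_smul_left]
        rw [integral_const_mul, integral_const_mul, hz.integral_div X hX]
        ring
    exact this.congr (Lp.coeFn_smul _ _).symm (Lp.coeFn_smul _ _).symm

theorem IsH1WithGrad.toLp_mem {d : ℕ} {u : USphere d → ℝ}
    {G : USphere d → EuclideanSpace ℝ (Fin d)} (h : IsH1WithGrad u G) :
    (h.memLp_fun.toLp u, h.memLp_grad.toLp G) ∈ sphereH1 d :=
  h.congr h.memLp_fun.coeFn_toLp.symm h.memLp_grad.coeFn_toLp.symm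

theorem inner_Lp_toLp {d : ℕ} {F : Type*} [NormedAddCommGroup F] [InnerProductSpace ℝ F]
    (G : Lp F 2 (surfMeas d)) {H : USphere d → F} (hH : MemLp H 2 (surfMeas d)) :
    inner ℝ G (hH.toLp H) = ∫ x, inner ℝ (G x) (H x) ∂surfMeas d := by
  rw [L2.inner_def]
  exact integral_congr_ae (hH.coeFn_toLp.mono fun x hx => by simp only [hx])

theorem inner_sphereDiv {d : ℕ} {z : Lp ℝ 2 (surfMeas d) × Lp (EuclideanSpace ℝ (Fin d)) 2 (surfMeas d)}
    (hz : z ∈ sphereH1 d) {X : EuclideanSpace ℝ (Fin d) → EuclideanSpace ℝ (Fin d)}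
    (hX : IsSmoothTangentField X) :
    inner ℝ z.1 ((memLp_sphereDiv hX).toLp _) = - inner ℝ z.2 (hX.memLp.toLp _) := by
  rw [inner_Lp_toLp, inner_Lp_toLp, ← IsH1WithGrad.integral_div hz X hX]
  simp [mul_comm]

/-- Tangency survives along an a.e. convergent subsequence, and the weak identity is an equality of
pairings with fixed `L²` elements. -/
theorem isClosed_sphereH1 (d : ℕ) : IsClosed (sphereH1 d).carrier := by
  refine IsSeqClosed.isClosed fun z y hz hzy => ?_
  have h1 : Filter.Tendsto (fun n => (z n).1) Filter.atTop (nhds y.1) :=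
    (continuous_fst.tendsto y).comp hzy
  have h2 : Filter.Tendsto (fun n => (z n).2) Filter.atTop (nhds y.2) :=
    (continuous_snd.tendsto y).comp hzy
  refine ⟨Lp.memLp _, Lp.memLp _, ?_, fun X hX => ?_⟩
  · obtain ⟨ns, -, hns⟩ := (tendstoInMeasure_of_tendsto_Lp h2).exists_seq_tendsto_ae
    have ht : ∀ᵐ x ∂surfMeas d, ∀ n, inner ℝ ((z n).2 x) x.1 = 0 :=
      ae_all_iff.2 fun n => IsH1WithGrad.tangent (hz n)
    filter_upwards [hns, ht] with x h3 h4
    have h5 := h3.inner (tendsto_const_nhds (x := x.1)) (𝕜 := ℝ)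
    simp only [h4] at h5
    exact tendsto_nhds_unique h5 tendsto_const_nhds
  · have h3 := h1.inner (tendsto_const_nhds (x := (memLp_sphereDiv hX).toLp _)) (𝕜 := ℝ)
    have h4 := (h2.inner (tendsto_const_nhds (x := hX.memLp.toLp _)) (𝕜 := ℝ)).neg
    simp only [fun n => inner_sphereDiv (hz n) hX] at h3
    have h5 := tendsto_nhds_unique h3 h4
    rw [inner_Lp_toLp, inner_Lp_toLp] at h5
    rw [← h5]
    simp [mul_comm]

/-! ### The spectral estimate -/

/-- The tangential gradient of a polynomial as a square-integrable vector field. -/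
noncomputable def polyGradLp {d : ℕ} (p : MvPolynomial (Fin d) ℝ) :
    Lp (EuclideanSpace ℝ (Fin d)) 2 (surfMeas d) :=
  (isSmoothTangentField_tgrad (contDiff_pev p)).memLp.toLp _

theorem polyLp_polyGradLp_mem {d : ℕ} [NeZero d] (p : MvPolynomial (Fin d) ℝ) :
    (polyLp d p, polyGradLp p) ∈ sphereH1 d :=
  (isH1WithGrad_of_contDiff (contDiff_pev p)).congr (coeFn_polyLp p).symm
    (isSmoothTangentField_tgrad (contDiff_pev p)).memLp.coeFn_toLp.symm

theorem inner_polyLp_sphereLap {d : ℕ}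
    {z : Lp ℝ 2 (surfMeas d) × Lp (EuclideanSpace ℝ (Fin d)) 2 (surfMeas d)}
    (hz : z ∈ sphereH1 d) (p : MvPolynomial (Fin d) ℝ) :
    inner ℝ z.1 (polyLp d (sphereLap d p)) = - inner ℝ z.2 (polyGradLp p) := by
  have hX := isSmoothTangentField_tgrad (contDiff_pev p)
  rw [polyGradLp, ← inner_sphereDiv hz hX]
  congr 1
  apply Lp.ext
  filter_upwards [coeFn_polyLp (sphereLap d p), (memLp_sphereDiv hX).coeFn_toLp] with x h1 h2
  rw [h1, h2, sphereDiv_tgrad_pev]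

theorem inner_polyLp_sphereLap_comm {d : ℕ} [NeZero d] (p q : MvPolynomial (Fin d) ℝ) :
    inner ℝ (polyLp d p) (polyLp d (sphereLap d q)) =
      inner ℝ (polyLp d (sphereLap d p)) (polyLp d q) := by
  rw [← real_inner_comm (polyLp d (sphereLap d p))]
  have h1 := inner_polyLp_sphereLap (polyLp_polyGradLp_mem p) q
  have h2 := inner_polyLp_sphereLap (polyLp_polyGradLp_mem q) p
  simp only at h1 h2
  rw [h1, h2, real_inner_comm]

/-- Orthogonal projection onto a finite-dimensional space. It is expressed by a representing
polynomial `q`, so that `sphereLap` can be applied to it. -/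
theorem exists_polyLp_projection {d : ℕ} (m : ℕ) (U : Lp ℝ 2 (surfMeas d)) :
    ∃ q ∈ restrictTotalDegree (Fin d) ℝ m, ∀ s ∈ restrictTotalDegree (Fin d) ℝ m,
      inner ℝ (polyLp d s) (U - polyLp d q) = 0 := by
  set P := (restrictTotalDegree (Fin d) ℝ m).map (polyLp d)
  obtain ⟨q, hq, hqU⟩ := Submodule.mem_map.1 (P.starProjection_apply_mem U)
  refine ⟨q, hq, fun s hs => ?_⟩
  rw [hqU]
  exact (Submodule.mem_orthogonal _ _).1 (P.sub_starProjection_mem_orthogonal U) _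
    (Submodule.mem_map_of_mem hs)

theorem restrictTotalDegree_mono {d k m : ℕ} (h : k ≤ m) :
    restrictTotalDegree (Fin d) ℝ k ≤ restrictTotalDegree (Fin d) ℝ m := fun _ hp =>
  (mem_restrictTotalDegree _ _ _).2 (((mem_restrictTotalDegree _ _ _).1 hp).trans h)

/-- The function `sphereLap d w + sphereEig d (m + 1) • w` has degree at most `m`, and by symmetry
is orthogonal to everything of degree at most `m`; hence it is orthogonal to itself. -/
theorem polyLp_sphereLap_eq_neg_smul {d m : ℕ} [NeZero d] {w : MvPolynomial (Fin d) ℝ}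
    (hw : w ∈ restrictTotalDegree (Fin d) ℝ (m + 1))
    (hperp : ∀ s ∈ restrictTotalDegree (Fin d) ℝ m, inner ℝ (polyLp d s) (polyLp d w) = 0) :
    polyLp d (sphereLap d w) = -(sphereEig d (m + 1) • polyLp d w) := by
  rw [eq_neg_iff_add_eq_zero, ← map_smul, ← map_add]
  have he := sphereLap_add_smul_mem hw
  have h : ∀ e ∈ restrictTotalDegree (Fin d) ℝ m,
      inner ℝ (polyLp d e) (polyLp d (sphereLap d w + sphereEig d (m + 1) • w)) = 0 := by
    intro e he
    rw [map_add, map_smul, inner_add_right, inner_smul_right, inner_polyLp_sphereLap_comm,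
      hperp _ (sphereLap_mem he), hperp _ he]
    simp
  exact inner_self_eq_zero.1 (h _ he)

theorem sphereEig_mul_norm_sq_le_of_poly {d : ℕ} [NeZero d] (k m : ℕ) :
    ∀ p ∈ restrictTotalDegree (Fin d) ℝ m,
      (∀ s ∈ restrictTotalDegree (Fin d) ℝ k, inner ℝ (polyLp d s) (polyLp d p) = 0) →
      sphereEig d (k + 1) * ‖polyLp d p‖ ^ 2 ≤
        - inner ℝ (polyLp d p) (polyLp d (sphereLap d p)) := by
  have base : ∀ p ∈ restrictTotalDegree (Fin d) ℝ k,
      (∀ s ∈ restrictTotalDegree (Fin d) ℝ k, inner ℝ (polyLp d s) (polyLp d p) = 0) →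
      sphereEig d (k + 1) * ‖polyLp d p‖ ^ 2 ≤
        - inner ℝ (polyLp d p) (polyLp d (sphereLap d p)) := by
    intro p hp hperp
    rw [inner_self_eq_zero.1 (hperp p hp)]
    simp
  induction m with
  | zero => exact fun p hp => base p (restrictTotalDegree_mono (Nat.zero_le k) hp)
  | succ m ih =>
    intro p hp hperp
    by_cases hmk : m + 1 ≤ k
    · exact base p (restrictTotalDegree_mono hmk hp) hperp
    have hkm : k ≤ m := by omega
    obtain ⟨q, hq, hqp⟩ := exists_polyLp_projection m (polyLp d p)
    -- `w` is an eigenfunction orthogonal to degree at most `m`, so all cross terms vanish; its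
    -- eigenvalue is at least `sphereEig d (k + 1)` because `k ≤ m`.
    obtain ⟨w, rfl⟩ : ∃ w, p = q + w := ⟨p - q, by ring⟩
    have hw : ∀ s ∈ restrictTotalDegree (Fin d) ℝ m,
        inner ℝ (polyLp d s) (polyLp d w) = 0 := fun s hs => by
      have := hqp s hs
      rwa [map_add, add_sub_cancel_left] at this
    have hwm : w ∈ restrictTotalDegree (Fin d) ℝ (m + 1) := by
      have := Submodule.sub_mem _ hp (restrictTotalDegree_mono (Nat.le_succ m) hq)
      rwa [add_sub_cancel_left] at this
    have hqk := ih q hq fun s hs => by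
      have := hperp s hs
      rwa [map_add, inner_add_right, hw s (restrictTotalDegree_mono hkm hs), add_zero] at this
    have heig := polyLp_sphereLap_eq_neg_smul hwm hw
    have h1 := hw q hq
    have h2 : inner ℝ (polyLp d w) (polyLp d (sphereLap d q)) = 0 := by
      rw [real_inner_comm]; exact hw _ (sphereLap_mem hq)
    have h3 := sphereEig_mono (d := d) NeZero.one_le hkm
    have h4 : ‖polyLp d (q + w)‖ ^ 2 = ‖polyLp d q‖ ^ 2 + ‖polyLp d w‖ ^ 2 := by
      rw [map_add, norm_add_sq_real, h1]; ring
    rw [h4, map_add, map_add, map_add, heig]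
    simp only [inner_add_left, inner_add_right, inner_neg_right, inner_smul_right, h1, h2,
      real_inner_self_eq_norm_sq]
    nlinarith [mul_le_mul_of_nonneg_right h3 (sq_nonneg ‖polyLp d w‖)]

/-- `sphereLap d q` still has degree at most `m`, hence is orthogonal to `z.1 - q`. Integrating by
parts, the gradients of `q` and of `z - q` are orthogonal too, which gives Pythagoras for the
energies. -/
theorem inner_polyGradLp_of_projection {d m : ℕ} [NeZero d]
    {z : Lp ℝ 2 (surfMeas d) × Lp (EuclideanSpace ℝ (Fin d)) 2 (surfMeas d)}
    (hz : z ∈ sphereH1 d) {q : MvPolynomial (Fin d) ℝ}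
    (hq : q ∈ restrictTotalDegree (Fin d) ℝ m)
    (hqz : ∀ s ∈ restrictTotalDegree (Fin d) ℝ m, inner ℝ (polyLp d s) (z.1 - polyLp d q) = 0) :
    inner ℝ z.2 (polyGradLp q) = ‖polyGradLp q‖ ^ 2 := by
  have h1 := inner_polyLp_sphereLap hz q
  have h2 := inner_polyLp_sphereLap (polyLp_polyGradLp_mem q) q
  have h3 := hqz _ (sphereLap_mem hq)
  rw [real_inner_comm, inner_sub_left] at h3
  simp only at h2
  rw [← real_inner_self_eq_norm_sq]
  linarith

theorem norm_polyGradLp_le_of_projection {d m : ℕ} [NeZero d]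
    {z : Lp ℝ 2 (surfMeas d) × Lp (EuclideanSpace ℝ (Fin d)) 2 (surfMeas d)}
    (hz : z ∈ sphereH1 d) {q : MvPolynomial (Fin d) ℝ}
    (hq : q ∈ restrictTotalDegree (Fin d) ℝ m)
    (hqz : ∀ s ∈ restrictTotalDegree (Fin d) ℝ m, inner ℝ (polyLp d s) (z.1 - polyLp d q) = 0) :
    ‖polyGradLp q‖ ^ 2 ≤ ‖z.2‖ ^ 2 ∧ ‖z.2 - polyGradLp q‖ ^ 2 ≤ ‖z.2‖ ^ 2 := by
  have h := inner_polyGradLp_of_projection hz hq hqz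
  have h2 := norm_sub_sq_real z.2 (polyGradLp q)
  rw [h] at h2
  constructor <;> nlinarith [sq_nonneg ‖z.2 - polyGradLp q‖, sq_nonneg ‖polyGradLp q‖]

theorem norm_sub_projection_le {d m : ℕ} {U : Lp ℝ 2 (surfMeas d)} {q s : MvPolynomial (Fin d) ℝ}
    (hq : q ∈ restrictTotalDegree (Fin d) ℝ m) (hs : s ∈ restrictTotalDegree (Fin d) ℝ m)
    (hqU : ∀ s ∈ restrictTotalDegree (Fin d) ℝ m, inner ℝ (polyLp d s) (U - polyLp d q) = 0) :
    ‖U - polyLp d q‖ ≤ ‖U - polyLp d s‖ := by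
  have h := hqU (q - s) (Submodule.sub_mem _ hq hs)
  have h2 : U - polyLp d s = polyLp d (q - s) + (U - polyLp d q) := by rw [map_sub]; abel
  have h3 := norm_add_sq_real (polyLp d (q - s)) (U - polyLp d q)
  rw [h, ← h2] at h3
  refine (sq_le_sq₀ (norm_nonneg _) (norm_nonneg _)).1 ?_
  nlinarith [sq_nonneg ‖polyLp d (q - s)‖]

/-- The sharp Poincaré inequality on the sphere for functions orthogonal to the polynomials of
degree at most `k`. -/
theorem sphereEig_mul_norm_sq_le {d k : ℕ} [NeZero d]
    {z : Lp ℝ 2 (surfMeas d) × Lp (EuclideanSpace ℝ (Fin d)) 2 (surfMeas d)}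
    (hz : z ∈ sphereH1 d)
    (hperp : ∀ s ∈ restrictTotalDegree (Fin d) ℝ k, inner ℝ (polyLp d s) z.1 = 0) :
    sphereEig d (k + 1) * ‖z.1‖ ^ 2 ≤ ‖z.2‖ ^ 2 := by
  have key : ∀ U ∈ Set.range (polyLp d), ∃ q, ‖z.1 - polyLp d q‖ ≤ ‖z.1 - U‖ ∧
      sphereEig d (k + 1) * ‖polyLp d q‖ ^ 2 ≤ ‖z.2‖ ^ 2 := by
    rintro _ ⟨p, rfl⟩
    -- Degree at least `p.totalDegree` makes `q` approximate no worse than `p`; degree at least `k`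
    -- keeps `q` orthogonal to the polynomials of degree at most `k`.
    obtain ⟨q, hq, hqz⟩ := exists_polyLp_projection (max k p.totalDegree) z.1
    refine ⟨q, norm_sub_projection_le hq ((mem_restrictTotalDegree _ _ _).2 (le_max_right _ _)) hqz,
      ?_⟩
    refine le_trans ?_ (norm_polyGradLp_le_of_projection hz hq hqz).1
    refine (sphereEig_mul_norm_sq_le_of_poly k _ q hq fun s hs => ?_).trans ?_
    · have := hqz s (restrictTotalDegree_mono (le_max_left _ _) hs)
      rw [inner_sub_right, hperp s hs] at this
      linarith
    · have := inner_polyLp_sphereLap (polyLp_polyGradLp_mem q) q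
      simp only at this
      rw [this, real_inner_self_eq_norm_sq, neg_neg]
  have hdense := denseRange_polyLp d
  have hseq : ∀ n : ℕ, ∃ q, ‖z.1 - polyLp d q‖ ≤ 1 / ((n : ℝ) + 1) ∧
      sphereEig d (k + 1) * ‖polyLp d q‖ ^ 2 ≤ ‖z.2‖ ^ 2 := fun n => by
    obtain ⟨p, hp⟩ := hdense.exists_dist_lt z.1 (ε := 1 / ((n : ℝ) + 1)) (by positivity)
    obtain ⟨q, h1, h2⟩ := key _ ⟨p, rfl⟩
    exact ⟨q, h1.trans (by rw [← dist_eq_norm]; exact hp.le), h2⟩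
  choose q hq1 hq2 using hseq
  have hlim : Filter.Tendsto (fun n => polyLp d (q n)) Filter.atTop (nhds z.1) := by
    rw [tendsto_iff_norm_sub_tendsto_zero]
    refine squeeze_zero (fun _ => norm_nonneg _) (fun n => ?_)
      tendsto_one_div_add_atTop_nhds_zero_nat
    rw [norm_sub_rev]; exact hq1 n
  exact le_of_tendsto' ((hlim.norm.pow 2).const_mul _) hq2

/-! ### Rellich compactness -/

theorem exists_sphereEig_gt {d : ℕ} [NeZero d] (C : ℝ) : ∃ k, C < sphereEig d (k + 1) := by
  obtain ⟨k, hk⟩ := exists_nat_gt (max C 1)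
  refine ⟨k, ?_⟩
  have hd : (1 : ℝ) ≤ d := by exact_mod_cast NeZero.one_le (n := d)
  have h1 := (le_max_left C 1).trans_lt hk
  have h2 := (le_max_right C 1).trans_lt hk
  unfold sphereEig
  push_cast
  nlinarith

/-- Rellich's theorem on the sphere. -/
theorem totallyBounded_sphereH1_ball (d : ℕ) [NeZero d] (C : ℝ) :
    TotallyBounded (Prod.fst '' {z | z ∈ sphereH1 d ∧ ‖z.1‖ ≤ C ∧ ‖z.2‖ ≤ C}) := by
  rw [Metric.totallyBounded_iff]
  intro ε hε
  -- With this `k`, the part of `z.1` orthogonal to degree at most `k` has norm below `ε / 2`, since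
  -- its energy is at most `C ^ 2`. The projected part stays in a compact ball of a
  -- finite-dimensional space.
  obtain ⟨k, hk⟩ := exists_sphereEig_gt (d := d) (C ^ 2 / (ε / 2) ^ 2)
  set P := (restrictTotalDegree (Fin d) ℝ k).map (polyLp d)
  have hK : TotallyBounded ((Subtype.val : P → _) '' Metric.closedBall 0 C) :=
    ((isCompact_closedBall (0 : P) C).image continuous_subtype_val).totallyBounded
  obtain ⟨t, ht, hcov⟩ := Metric.totallyBounded_iff.1 hK (ε / 2) (by positivity)
  refine ⟨t, ht, ?_⟩
  rintro _ ⟨z, ⟨hz, hz1, hz2⟩, rfl⟩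
  obtain ⟨q, hq, hqz⟩ := exists_polyLp_projection k z.1
  have hC : 0 ≤ C := (norm_nonneg _).trans hz1
  have hqC : ‖polyLp d q‖ ≤ C := by
    have h := hqz q hq
    have h3 := norm_add_sq_real (polyLp d q) (z.1 - polyLp d q)
    rw [h, add_sub_cancel] at h3
    refine le_trans ?_ hz1
    refine (sq_le_sq₀ (norm_nonneg _) (norm_nonneg _)).1 ?_
    nlinarith [sq_nonneg ‖z.1 - polyLp d q‖]
  have hfar : ‖z.1 - polyLp d q‖ < ε / 2 := by
    have h := sphereEig_mul_norm_sq_le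
      (Submodule.sub_mem _ hz (polyLp_polyGradLp_mem q)) (k := k) hqz
    simp only [Prod.fst_sub, Prod.snd_sub] at h
    have h2 := (norm_polyGradLp_le_of_projection hz hq hqz).2
    have h3 : ‖z.2‖ ^ 2 ≤ C ^ 2 := by gcongr
    rw [div_lt_iff₀ (by positivity)] at hk
    by_contra! hcon
    have h4 : (ε / 2) ^ 2 ≤ ‖z.1 - polyLp d q‖ ^ 2 := by gcongr
    have h5 : 0 < sphereEig d (k + 1) := by
      by_contra! hneg
      nlinarith [sq_nonneg C, sq_nonneg (ε / 2)]
    nlinarith [mul_le_mul_of_nonneg_left h4 h5.le]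
  have hmem := hcov ⟨⟨polyLp d q, Submodule.mem_map_of_mem hq⟩, by simpa using hqC, rfl⟩
  simp only [Set.mem_iUnion, Metric.mem_ball, exists_prop] at hmem ⊢
  obtain ⟨y, hy, hyq⟩ := hmem
  refine ⟨y, hy, (dist_triangle _ (polyLp d q) _).trans_lt ?_⟩
  rw [dist_eq_norm]
  linarith

/-! ### Abstract minimization of a Rayleigh quotient -/

theorem eq_zero_of_forall_nonneg_quadratic {L R : ℝ} (h : ∀ t : ℝ, 0 ≤ 2 * t * L + t ^ 2 * R) :
    L = 0 := by
  have := discrim_le_zero (a := R) (b := 2 * L) (c := 0) fun t => by linarith [h t]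
  unfold discrim at this
  nlinarith

section Minimizer

variable {E F : Type*} [NormedAddCommGroup E] [NormedSpace ℝ E]
  [NormedAddCommGroup F] [NormedSpace ℝ F]
  {V : Submodule ℝ (E × F)} {b : E →L[ℝ] E →L[ℝ] ℝ} {q : F →L[ℝ] F →L[ℝ] ℝ}

/-- The Euler–Lagrange equation of a minimizer of the quotient of two quadratic forms. -/
theorem eulerLagrange_of_minimizer (hb : ∀ u v, b u v = b v u) (hq : ∀ u v, q u v = q v u)
    {l : ℝ} (hmin : ∀ y ∈ V, l * b y.1 y.1 ≤ q y.2 y.2)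
    {z : E × F} (hz : z ∈ V) (hzl : q z.2 z.2 = l * b z.1 z.1) {y : E × F} (hy : y ∈ V) :
    q z.2 y.2 = l * b z.1 y.1 := by
  rw [← sub_eq_zero]
  -- Expand the minimality inequality at `z + t y`; the constant term in `t` vanishes because `z`
  -- attains the minimum.
  refine eq_zero_of_forall_nonneg_quadratic (R := q y.2 y.2 - l * b y.1 y.1) fun t => ?_
  have h := hmin _ (V.add_mem hz (V.smul_mem t hy))
  simp only [Prod.fst_add, Prod.snd_add, Prod.smul_fst, Prod.smul_snd, map_add, map_smul,
    add_apply, smul_apply, smul_eq_mul, hb y.1 z.1, hq y.2 z.2] at h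
  linarith

variable [CompleteSpace E] [CompleteSpace F]

/-- A quotient of coercive quadratic forms attains its minimum when the embedding is compact. -/
theorem exists_minimizer_of_totallyBounded (hV : IsClosed V.carrier)
    (hb : ∀ u v, b u v = b v u) (hq : ∀ u v, q u v = q v u) {m : ℝ} (hm : 0 < m)
    (hbm : ∀ u, m * ‖u‖ ^ 2 ≤ b u u) (hqm : ∀ u, m * ‖u‖ ^ 2 ≤ q u u)
    (hcomp : ∀ C : ℝ, TotallyBounded (Prod.fst '' {z | z ∈ V ∧ ‖z.1‖ ≤ C ∧ ‖z.2‖ ≤ C}))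
    (hne : ∃ z ∈ V, z.1 ≠ 0) :
    ∃ l : ℝ, ∃ z ∈ V, z.1 ≠ 0 ∧ q z.2 z.2 = l * b z.1 z.1 ∧
      ∀ y ∈ V, l * b y.1 y.1 ≤ q y.2 y.2 := by
  have hq0 : ∀ u, 0 ≤ q u u := fun u => (by positivity : 0 ≤ m * ‖u‖ ^ 2).trans (hqm u)
  have hb0 : ∀ u, u ≠ 0 → 0 < b u u := fun u hu =>
    (mul_pos hm (pow_pos (norm_pos_iff.2 hu) 2)).trans_le (hbm u)
  have hbc : Continuous fun u => b u u := b.continuous.clm_apply continuous_id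
  have hqc : Continuous fun u => q u u := q.continuous.clm_apply continuous_id
  set S : Set ℝ := {r | ∃ z ∈ V, b z.1 z.1 = 1 ∧ r = q z.2 z.2} with hS
  have hscale : ∀ z ∈ V, z.1 ≠ 0 → q z.2 z.2 / b z.1 z.1 ∈ S := by
    intro z hz hz1
    have h := hb0 _ hz1
    refine ⟨(√(b z.1 z.1))⁻¹ • z, V.smul_mem _ hz, ?_, ?_⟩
    · simp only [Prod.smul_fst, map_smul, smul_apply, smul_eq_mul, ← mul_assoc, ← mul_inv,
        Real.mul_self_sqrt h.le]
      exact inv_mul_cancel₀ h.ne'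
    · simp only [Prod.smul_snd, map_smul, smul_apply, smul_eq_mul, ← mul_assoc, ← mul_inv,
        Real.mul_self_sqrt h.le]
      rw [div_eq_inv_mul]
  have hSne : S.Nonempty := by
    obtain ⟨z, hz, hz1⟩ := hne
    exact ⟨_, hscale z hz hz1⟩
  have hSbdd : BddBelow S := ⟨0, by rintro _ ⟨z, -, -, rfl⟩; exact hq0 _⟩
  set l := sInf S with hl
  have hl0 : 0 ≤ l := le_csInf hSne (by rintro _ ⟨z, -, -, rfl⟩; exact hq0 _)
  have hlow : ∀ y ∈ V, l * b y.1 y.1 ≤ q y.2 y.2 := by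
    intro y hy
    by_cases hy1 : y.1 = 0
    · rw [hy1]; simpa using hq0 _
    · exact (le_div_iff₀ (hb0 _ hy1)).1 (csInf_le hSbdd (hscale y hy hy1))
  have hseq : ∀ n : ℕ, ∃ z ∈ V, b z.1 z.1 = 1 ∧ q z.2 z.2 < l + 1 / ((n : ℝ) + 1) := by
    intro n
    obtain ⟨_, ⟨z, hz, h1, rfl⟩, h2⟩ := exists_lt_of_csInf_lt hSne
      (show sInf S < l + 1 / ((n : ℝ) + 1) from lt_add_of_pos_right _ (by positivity))
    exact ⟨z, hz, h1, h2⟩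
  choose z hzV hz1 hz2 using hseq
  obtain ⟨C, hC⟩ : ∃ C : ℝ, ∀ n, ‖(z n).1‖ ≤ C ∧ ‖(z n).2‖ ≤ C := by
    refine ⟨√((l + 1) / m), fun n => ⟨Real.le_sqrt_of_sq_le ?_, Real.le_sqrt_of_sq_le ?_⟩⟩ <;>
      rw [le_div_iff₀ hm]
    · linarith [hbm (z n).1, hz1 n]
    · have : 1 / ((n : ℝ) + 1) ≤ 1 := by
        rw [div_le_one (by positivity)]; linarith [n.cast_nonneg (α := ℝ)]
      linarith [hqm (z n).2, hz2 n]
  have hK : IsCompact (closure (Prod.fst '' {z | z ∈ V ∧ ‖z.1‖ ≤ C ∧ ‖z.2‖ ≤ C})) :=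
    (hcomp C).closure.isCompact_of_isClosed isClosed_closure
  obtain ⟨u, -, φ, hφ, hu⟩ := hK.tendsto_subseq
    (x := fun n => (z n).1) fun n => subset_closure ⟨z n, ⟨hzV n, hC n⟩, rfl⟩
  -- Compactness controls only the first components. For the second, use the parallelogram law for
  -- `q` and `b` together with `q ≥ l b` at `z i + z j`: almost-minimizers whose first components
  -- are close have close second components.
  have hest : ∀ i j, ‖(z i).2 - (z j).2‖ ^ 2 ≤
      (2 * (1 / ((i : ℝ) + 1)) + 2 * (1 / ((j : ℝ) + 1)) +
        l * b ((z i).1 - (z j).1) ((z i).1 - (z j).1)) / m := by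
    intro i j
    rw [le_div_iff₀ hm, mul_comm]
    refine (hqm _).trans ?_
    have h := hlow _ (V.add_mem (hzV i) (hzV j))
    have h1 := hz1 i
    have h2 := hz1 j
    have h3 := hz2 i
    have h4 := hz2 j
    simp only [Prod.fst_add, Prod.snd_add, map_add, add_apply, map_sub, sub_apply,
      hb (z j).1 (z i).1, hq (z j).2 (z i).2, h1, h2] at h ⊢
    linarith
  have hfst : Filter.Tendsto (fun n : ℕ × ℕ => φ n.1) Filter.atTop Filter.atTop := by
    rw [← Filter.prod_atTop_atTop_eq]; exact hφ.tendsto_atTop.comp Filter.tendsto_fst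
  have hsnd : Filter.Tendsto (fun n : ℕ × ℕ => φ n.2) Filter.atTop Filter.atTop := by
    rw [← Filter.prod_atTop_atTop_eq]; exact hφ.tendsto_atTop.comp Filter.tendsto_snd
  have hcauchy : CauchySeq fun n => (z (φ n)).2 := by
    rw [cauchySeq_iff_tendsto_dist_atTop_0]
    have hdiff : Filter.Tendsto (fun n : ℕ × ℕ => (z (φ n.1)).1 - (z (φ n.2)).1) Filter.atTop
        (nhds (u - u)) := by
      rw [← Filter.prod_atTop_atTop_eq]
      exact (hu.comp Filter.tendsto_fst).sub (hu.comp Filter.tendsto_snd)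
    have hbt : Filter.Tendsto (fun n : ℕ × ℕ => b ((z (φ n.1)).1 - (z (φ n.2)).1)
        ((z (φ n.1)).1 - (z (φ n.2)).1)) Filter.atTop (nhds 0) := by
      have := (hbc.tendsto _).comp hdiff
      simpa [Function.comp_def] using this
    have h1 := (tendsto_one_div_add_atTop_nhds_zero_nat (𝕜 := ℝ)).comp hfst
    have h2 := (tendsto_one_div_add_atTop_nhds_zero_nat (𝕜 := ℝ)).comp hsnd
    have hr := (((h1.const_mul 2).add (h2.const_mul 2)).add (hbt.const_mul l)).div_const m
    have hsq : Filter.Tendsto (fun n : ℕ × ℕ => ‖(z (φ n.1)).2 - (z (φ n.2)).2‖ ^ 2)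
        Filter.atTop (nhds 0) := by
      refine squeeze_zero (fun _ => by positivity) (fun n => hest _ _) ?_
      simpa using hr
    have := hsq.sqrt
    simpa [Real.sqrt_sq (norm_nonneg _), dist_eq_norm] using this
  obtain ⟨g, hg⟩ := cauchySeq_tendsto_of_complete hcauchy
  have hmem : (u, g) ∈ V :=
    hV.mem_of_tendsto (hu.prodMk_nhds hg) (.of_forall fun n => hzV (φ n))
  have hbu : b u u = 1 := by
    have h := (hbc.tendsto _).comp hu
    exact tendsto_nhds_unique h (tendsto_const_nhds.congr fun n => (hz1 (φ n)).symm)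
  have hqg : q g g ≤ l := by
    have h := (hqc.tendsto _).comp hg
    have h2 := ((tendsto_one_div_add_atTop_nhds_zero_nat (𝕜 := ℝ)).comp
      hφ.tendsto_atTop).const_add l
    rw [add_zero] at h2
    exact le_of_tendsto_of_tendsto' h h2 fun n => (hz2 (φ n)).le
  refine ⟨l, (u, g), hmem, fun h => ?_, ?_, hlow⟩
  · simp only at h
    rw [h] at hbu
    simp at hbu
  · refine le_antisymm ?_ (hlow _ hmem)
    simpa only [hbu, mul_one] using hqg

end Minimizer

/-! ### The weighted forms -/

/-- The weighted `L²` inner product `∫ a ⟨f, g⟩` with a bounded weight. -/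
noncomputable def weightedForm {d : ℕ} (F : Type*) [NormedAddCommGroup F] [InnerProductSpace ℝ F]
    (a : Lp ℝ ⊤ (surfMeas d)) : Lp F 2 (surfMeas d) →L[ℝ] Lp F 2 (surfMeas d) →L[ℝ] ℝ :=
  (innerSL ℝ : Lp F 2 (surfMeas d) →L[ℝ] Lp F 2 (surfMeas d) →L[ℝ] ℝ).comp
    ((ContinuousLinearMap.lsmul ℝ ℝ : ℝ →L[ℝ] F →L[ℝ] F).holderL (surfMeas d) ⊤ 2 2 a)

theorem weightedForm_apply {d : ℕ} {F : Type*} [NormedAddCommGroup F] [InnerProductSpace ℝ F]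
    {a : USphere d → ℝ} (ha : MemLp a ⊤ (surfMeas d)) (f g : Lp F 2 (surfMeas d)) :
    weightedForm F (ha.toLp a) f g = ∫ x, a x * inner ℝ (f x) (g x) ∂surfMeas d := by
  change inner ℝ _ g = _
  rw [L2.inner_def]
  refine integral_congr_ae ?_
  filter_upwards [ha.coeFn_toLp,
    (ContinuousLinearMap.lsmul ℝ ℝ : ℝ →L[ℝ] F →L[ℝ] F).coeFn_holder (r := 2) (ha.toLp a) f]
    with x h1 h2
  erw [h2]
  rw [h1]
  simp [real_inner_smul_left]

theorem weightedForm_toLp {d : ℕ} {F : Type*} [NormedAddCommGroup F] [InnerProductSpace ℝ F]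
    {a : USphere d → ℝ} (ha : MemLp a ⊤ (surfMeas d)) {f g : USphere d → F}
    (hf : MemLp f 2 (surfMeas d)) (hg : MemLp g 2 (surfMeas d)) :
    weightedForm F (ha.toLp a) (hf.toLp f) (hg.toLp g) =
      ∫ x, a x * inner ℝ (f x) (g x) ∂surfMeas d := by
  rw [weightedForm_apply]
  refine integral_congr_ae ?_
  filter_upwards [hf.coeFn_toLp, hg.coeFn_toLp] with x h1 h2
  rw [h1, h2]

theorem weightedForm_comm {d : ℕ} {F : Type*} [NormedAddCommGroup F] [InnerProductSpace ℝ F]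
    {a : USphere d → ℝ} (ha : MemLp a ⊤ (surfMeas d)) (f g : Lp F 2 (surfMeas d)) :
    weightedForm F (ha.toLp a) f g = weightedForm F (ha.toLp a) g f := by
  simp only [weightedForm_apply, real_inner_comm]

theorem norm_sq_toLp {d : ℕ} {F : Type*} [NormedAddCommGroup F] [InnerProductSpace ℝ F]
    {f : USphere d → F} (hf : MemLp f 2 (surfMeas d)) :
    ‖hf.toLp f‖ ^ 2 = ∫ x, ‖f x‖ ^ 2 ∂surfMeas d := by
  rw [← real_inner_self_eq_norm_sq, inner_Lp_toLp]
  refine integral_congr_ae (hf.coeFn_toLp.mono fun x hx => ?_)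
  simp only [hx, real_inner_self_eq_norm_sq]

theorem integrable_weight_mul {d : ℕ} {a f : USphere d → ℝ} (ha : MemLp a ⊤ (surfMeas d))
    (hf : Integrable f (surfMeas d)) : Integrable (fun x => a x * f x) (surfMeas d) :=
  hf.mul_of_top_right ha

theorem le_weightedForm_self {d : ℕ} {F : Type*} [NormedAddCommGroup F] [InnerProductSpace ℝ F]
    {a : USphere d → ℝ} (ha : MemLp a ⊤ (surfMeas d)) {m : ℝ} (ham : ∀ᵐ x ∂surfMeas d, m ≤ a x)
    (f : Lp F 2 (surfMeas d)) : m * ‖f‖ ^ 2 ≤ weightedForm F (ha.toLp a) f f := by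
  have hi : Integrable (fun x => inner ℝ (f x) (f x)) (surfMeas d) :=
    integrable_inner_of_memLp (Lp.memLp f) (Lp.memLp f)
  rw [weightedForm_apply, ← real_inner_self_eq_norm_sq, L2.inner_def, ← integral_const_mul]
  refine integral_mono_ae (hi.const_mul m) (integrable_weight_mul ha hi) ?_
  filter_upwards [ham] with x hx
  exact mul_le_mul_of_nonneg_right hx real_inner_self_nonneg

/-- From `|ln a| ≤ C` follows `exp (-C) ≤ a ≤ exp C`. Measurability of `a` is recovered from that of
`ln a` through `a = exp (ln a)`. -/
theorem exists_bounds_of_memLp_log {d : ℕ} {a : USphere d → ℝ}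
    (hpos : ∀ᵐ x ∂surfMeas d, 0 < a x)
    (hlog : MemLp (fun x => Real.log (a x)) ⊤ (surfMeas d)) :
    MemLp a ⊤ (surfMeas d) ∧ ∃ m > 0, ∀ᵐ x ∂surfMeas d, m ≤ a x := by
  obtain ⟨C, hC⟩ : ∃ C : ℝ, ∀ᵐ x ∂surfMeas d, |Real.log (a x)| ≤ C := by
    have hfin := hlog.2
    rw [eLpNorm_exponent_top] at hfin
    refine ⟨(eLpNormEssSup (fun x => Real.log (a x)) (surfMeas d)).toReal, ?_⟩
    filter_upwards [ae_le_eLpNormEssSup (f := fun x => Real.log (a x)) (μ := surfMeas d)] with x hx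
    simpa using ENNReal.toReal_mono hfin.ne hx
  have hexp : ∀ᵐ x ∂surfMeas d, Real.exp (Real.log (a x)) = a x :=
    hpos.mono fun x hx => Real.exp_log hx
  refine ⟨?_, Real.exp (-C), Real.exp_pos _, ?_⟩
  · have hm : AEStronglyMeasurable a (surfMeas d) :=
      (Real.continuous_exp.comp_aestronglyMeasurable hlog.1).congr hexp
    refine MemLp.of_bound hm (Real.exp C) ?_
    filter_upwards [hexp, hC] with x h1 h2
    rw [← h1, Real.norm_of_nonneg (Real.exp_pos _).le]
    exact Real.exp_le_exp.2 (abs_le.1 h2).2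
  · filter_upwards [hexp, hC] with x h1 h2
    rw [← h1]
    exact Real.exp_le_exp.2 (abs_le.1 h2).1

/-! ### Constants and the Poincaré inequality -/

theorem isH1WithGrad_const {d : ℕ} [NeZero d] (c : ℝ) :
    IsH1WithGrad (d := d) (fun _ => c) (fun _ => 0) := by
  have h := isH1WithGrad_of_contDiff (d := d) (f := fun _ => c) contDiff_const
  have h0 : ∀ x : EuclideanSpace ℝ (Fin d), tgrad (fun _ => c) x = 0 := fun x => by
    simp [tgrad, gradient]
  simpa only [h0] using h

theorem IsH1WithGrad.sub_const {d : ℕ} [NeZero d] {u : USphere d → ℝ}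
    {G : USphere d → EuclideanSpace ℝ (Fin d)} (h : IsH1WithGrad u G) (c : ℝ) :
    IsH1WithGrad (fun x => u x - c) G where
  memLp_fun := h.memLp_fun.sub (memLp_const c)
  memLp_grad := h.memLp_grad
  tangent := h.tangent
  integral_div X hX := by
    have hi := integrable_of_continuous_sphere (continuous_sphereDiv hX.1)
    simp only [sub_mul]
    have hui : Integrable (fun x => u x * sphereDiv X x) (surfMeas d) :=
      h.memLp_fun.integrable_mul (memLp_sphereDiv hX)
    rw [integral_sub hui (hi.const_mul c),
      integral_const_mul, integral_sphereDiv_eq_zero hX, h.integral_div X hX]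
    ring

/-- The sharp Poincaré inequality on the sphere. -/
theorem IsH1WithGrad.poincare {d : ℕ} [NeZero d] {u : USphere d → ℝ}
    {G : USphere d → EuclideanSpace ℝ (Fin d)} (h : IsH1WithGrad u G)
    (hmean : ∫ x, u x ∂surfMeas d = 0) :
    ((d : ℝ) - 1) * ∫ x, u x ^ 2 ∂surfMeas d ≤ ∫ x, ‖G x‖ ^ 2 ∂surfMeas d := by
  -- Polynomials of degree at most zero are the constants, and the first nonzero level has
  -- eigenvalue `1 * (1 + d - 2)`.
  have hp := sphereEig_mul_norm_sq_le h.toLp_mem (k := 0) fun s hs => by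
    rw [mem_restrictTotalDegree, Nat.le_zero, totalDegree_eq_zero_iff_eq_C] at hs
    rw [hs, inner_Lp_toLp]
    have : ∀ᵐ x ∂surfMeas d, inner ℝ (polyLp d (C (coeff 0 s)) x) (u x) = coeff 0 s * u x := by
      filter_upwards [coeFn_polyLp (C (coeff 0 s) : MvPolynomial (Fin d) ℝ)] with x hx
      rw [hx]; simp [pev, mul_comm]
    rw [integral_congr_ae this, integral_const_mul, hmean, mul_zero]
  rw [norm_sq_toLp, norm_sq_toLp] at hp
  have h1 : sphereEig d (0 + 1) = (d : ℝ) - 1 := by simp [sphereEig]; ring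
  simpa [h1] using hp

theorem surfMeas_univ_pos (d : ℕ) [NeZero d] : 0 < (surfMeas d).real Set.univ := by
  have : Nonempty (USphere d) := ⟨⟨EuclideanSpace.single 0 1, by simp⟩⟩
  exact ENNReal.toReal_pos (isOpen_univ.measure_pos _ Set.univ_nonempty).ne' (measure_ne_top _ _)

instance neZero_surfMeas (d : ℕ) [NeZero d] : NeZero (surfMeas d) :=
  ⟨fun h => by simpa [h] using surfMeas_univ_pos d⟩

/-- Poincaré applied to `u` minus its mean. It needs `d - 1 > 0`: for `d = 1` the sphere is two
points. -/
theorem IsH1WithGrad.ae_eq_const_of_grad_eq_zero {d : ℕ} [NeZero d] (hd : 2 ≤ d)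
    {u : USphere d → ℝ} {G : USphere d → EuclideanSpace ℝ (Fin d)} (h : IsH1WithGrad u G)
    (hG : ∫ x, ‖G x‖ ^ 2 ∂surfMeas d = 0) : ∃ c : ℝ, ∀ᵐ x ∂surfMeas d, u x = c := by
  set c := (∫ x, u x ∂surfMeas d) / (surfMeas d).real Set.univ
  have hs := surfMeas_univ_pos d
  have hv := h.sub_const c
  have hp := hv.poincare (by
    rw [integral_sub (h.memLp_fun.integrable one_le_two) (integrable_const c), integral_const,
      smul_eq_mul, mul_div_cancel₀ _ hs.ne', sub_self])
  rw [hG] at hp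
  have hd' : (2 : ℝ) ≤ d := by exact_mod_cast hd
  have hnn : 0 ≤ ∫ x, (u x - c) ^ 2 ∂surfMeas d := integral_nonneg fun x => sq_nonneg _
  have h0 : ∫ x, (u x - c) ^ 2 ∂surfMeas d = 0 := by nlinarith
  rw [integral_eq_zero_iff_of_nonneg (fun x => sq_nonneg _) hv.memLp_fun.integrable_sq] at h0
  exact ⟨c, h0.mono fun x hx => sub_eq_zero.1 (pow_eq_zero_iff two_ne_zero |>.1 hx)⟩

/-! ### Coordinate functions on the sphere -/

theorem fderiv_coord_apply {d : ℕ} (i : Fin d) (x v : EuclideanSpace ℝ (Fin d)) :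
    fderiv ℝ (fun y : EuclideanSpace ℝ (Fin d) => y i) x v = v i := by
  rw [← fderiv_apply_coord (Y := fun y => y) differentiable_id]
  simp

theorem contDiff_coord {d : ℕ} (i : Fin d) :
    ContDiff ℝ ∞ fun y : EuclideanSpace ℝ (Fin d) => y i :=
  (EuclideanSpace.proj i : EuclideanSpace ℝ (Fin d) →L[ℝ] ℝ).contDiff

theorem inner_tgrad_coord {d : ℕ} (i : Fin d) {x v : EuclideanSpace ℝ (Fin d)}
    (h : inner ℝ v x = 0) : inner ℝ (tgrad (fun y => y i) x) v = v i := by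
  rw [inner_tgrad_of_inner_eq_zero _ h, fderiv_coord_apply]

theorem tgrad_apply {d : ℕ} (f : EuclideanSpace ℝ (Fin d) → ℝ) (x : EuclideanSpace ℝ (Fin d))
    (i : Fin d) :
    tgrad f x i = fderiv ℝ f x (EuclideanSpace.single i 1) - fderiv ℝ f x x * x i := by
  rw [tgrad, PiLp.sub_apply, gradient_apply, inner_gradient_left]
  rfl

theorem norm_sq_tgrad_coord {d : ℕ} (i : Fin d) (x : USphere d) :
    ‖tgrad (fun y => y i) x.1‖ ^ 2 = 1 - x.1 i ^ 2 := by
  rw [← real_inner_self_eq_norm_sq,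
    inner_tgrad_coord i ((isSmoothTangentField_tgrad (contDiff_coord i)).2 x), tgrad_apply,
    fderiv_coord_apply, fderiv_coord_apply]
  simp [pow_two]

theorem sum_sq_coord {d : ℕ} (x : USphere d) : ∑ i, x.1 i ^ 2 = 1 := by
  have := EuclideanSpace.norm_sq_eq x.1
  rw [norm_eq_of_mem_sphere x] at this
  simpa using this.symm

/-- The gradient of `xᵢ` is the tangential projection of the `i`-th basis vector, so the sum is the
tangential trace of the differential of `X`. This turns the summed Euler–Lagrange equations into a
divergence. -/
theorem sum_inner_tgrad_coord_tgrad {d : ℕ}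
    {X : EuclideanSpace ℝ (Fin d) → EuclideanSpace ℝ (Fin d)} (hX : ContDiff ℝ ∞ X)
    (x : USphere d) :
    ∑ i, inner ℝ (tgrad (fun y => y i) x.1) (tgrad (fun y => X y i) x.1) = sphereDiv X x := by
  have hXi : ∀ i, ContDiff ℝ ∞ fun y => X y i := fun i =>
    (EuclideanSpace.proj i : EuclideanSpace ℝ (Fin d) →L[ℝ] ℝ).contDiff.comp hX
  have hdiff : Differentiable ℝ X := hX.differentiable (by simp)
  unfold sphereDiv
  rw [PiLp.inner_apply]
  simp only [inner_tgrad_coord _ ((isSmoothTangentField_tgrad (hXi _)).2 x), tgrad_apply,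
    ← fderiv_apply_coord hdiff, Finset.sum_sub_distrib]
  simp [mul_comm]

/-! ### The weighted eigenvalue problem -/

section Weighted

variable {d : ℕ} {a : USphere d → ℝ}

theorem integral_weight_pos [NeZero d] (hpos : ∀ᵐ x ∂surfMeas d, 0 < a x) (ha : MemLp a ⊤ (surfMeas d)) :
    0 < ∫ x, a x ∂surfMeas d := by
  rw [integral_pos_iff_support_of_nonneg_ae (hpos.mono fun x hx => hx.le)
    (ha.integrable le_top)]
  have : Function.support a =ᵐ[surfMeas d] Set.univ := by
    filter_upwards [hpos] with x hx
    exact propext ⟨fun _ => trivial, fun _ => hx.ne'⟩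
  rw [measure_congr this]
  exact Measure.measure_univ_pos.2 (NeZero.ne _)

theorem integral_weight_sq_pos (hpos : ∀ᵐ x ∂surfMeas d, 0 < a x) (ha : MemLp a ⊤ (surfMeas d))
    {u : USphere d → ℝ} (hu : MemLp u 2 (surfMeas d)) (hne : ¬ u =ᵐ[surfMeas d] 0) :
    0 < ∫ x, a x * u x ^ 2 ∂surfMeas d := by
  have hnn : 0 ≤ᵐ[surfMeas d] fun x => a x * u x ^ 2 :=
    hpos.mono fun x hx => mul_nonneg hx.le (sq_nonneg _)
  refine (integral_nonneg_of_ae hnn).lt_of_ne fun h => hne ?_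
  have := (integral_eq_zero_iff_of_nonneg_ae hnn (integrable_weight_mul ha hu.integrable_sq)).1 h.symm
  filter_upwards [this, hpos] with x h1 h2
  have h3 := (mul_eq_zero.1 h1).resolve_left h2.ne'
  exact pow_eq_zero_iff two_ne_zero |>.1 h3

/-- The functions in `H¹` with zero weighted mean. -/
noncomputable def weightedH1 (a : Lp ℝ ⊤ (surfMeas d)) :
    Submodule ℝ (Lp ℝ 2 (surfMeas d) × Lp (EuclideanSpace ℝ (Fin d)) 2 (surfMeas d)) :=
  sphereH1 d ⊓ LinearMap.ker ((weightedForm ℝ a ((memLp_const (1 : ℝ)).toLp _)).comp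
    (ContinuousLinearMap.fst ℝ _ _)).toLinearMap

theorem isClosed_weightedH1 (a : Lp ℝ ⊤ (surfMeas d)) : IsClosed (weightedH1 a).carrier :=
  (isClosed_sphereH1 d).inter (ContinuousLinearMap.isClosed_ker _)

theorem toLp_mem_weightedH1 (ha : MemLp a ⊤ (surfMeas d)) {u : USphere d → ℝ}
    {G : USphere d → EuclideanSpace ℝ (Fin d)} (h : IsH1WithGrad u G)
    (hmean : ∫ x, a x * u x ∂surfMeas d = 0) :
    (h.memLp_fun.toLp u, h.memLp_grad.toLp G) ∈ weightedH1 (ha.toLp a) := by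
  refine ⟨h.toLp_mem, ?_⟩
  change weightedForm ℝ (ha.toLp a) _ (h.memLp_fun.toLp u) = 0
  rw [weightedForm_toLp]
  simpa using hmean

theorem integral_eq_zero_of_mem_weightedH1 (ha : MemLp a ⊤ (surfMeas d))
    {z : Lp ℝ 2 (surfMeas d) × Lp (EuclideanSpace ℝ (Fin d)) 2 (surfMeas d)}
    (hz : z ∈ weightedH1 (ha.toLp a)) : ∫ x, a x * z.1 x ∂surfMeas d = 0 := by
  have h : weightedForm ℝ (ha.toLp a) ((memLp_const (1 : ℝ)).toLp _) z.1 = 0 := hz.2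
  rw [weightedForm_comm, ← Lp.toLp_coeFn z.1 (Lp.memLp z.1), weightedForm_toLp] at h
  simpa using h

theorem rayleighInf_mul_le [NeZero d] (hpos : ∀ᵐ x ∂surfMeas d, 0 < a x) (ha : MemLp a ⊤ (surfMeas d))
    {u : USphere d → ℝ} {G : USphere d → EuclideanSpace ℝ (Fin d)} (h : IsH1WithGrad u G)
    (hmean : ∫ x, a x * u x ∂surfMeas d = 0) :
    rayleighInf a * ∫ x, a x * u x ^ 2 ∂surfMeas d ≤ ∫ x, a x * ‖G x‖ ^ 2 ∂surfMeas d := by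
  have hnn : ∀ H : USphere d → EuclideanSpace ℝ (Fin d),
      0 ≤ ∫ x, a x * ‖H x‖ ^ 2 ∂surfMeas d := fun H =>
    integral_nonneg_of_ae (hpos.mono fun x hx => mul_nonneg hx.le (sq_nonneg _))
  by_cases hu : u =ᵐ[surfMeas d] 0
  · have : ∫ x, a x * u x ^ 2 ∂surfMeas d = 0 := by
      rw [integral_congr_ae (g := fun _ => (0 : ℝ)) (hu.mono fun x hx => by simp [hx])]
      simp
    rw [this, mul_zero]
    exact hnn G
  · rw [← le_div_iff₀ (integral_weight_sq_pos hpos ha h.memLp_fun hu)]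
    refine csInf_le ⟨0, ?_⟩ ⟨u, G, h, hu, hmean, rfl⟩
    rintro _ ⟨v, H, -, -, -, rfl⟩
    exact div_nonneg (hnn H)
      (integral_nonneg_of_ae (hpos.mono fun x hx => mul_nonneg hx.le (sq_nonneg _)))

theorem IsH1WithGrad.eulerLagrange [NeZero d] (hpos : ∀ᵐ x ∂surfMeas d, 0 < a x)
    (ha : MemLp a ⊤ (surfMeas d))
    {u : USphere d → ℝ} {G : USphere d → EuclideanSpace ℝ (Fin d)} (h : IsH1WithGrad u G)
    (hmean : ∫ x, a x * u x ∂surfMeas d = 0)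
    (hmin : ∫ x, a x * ‖G x‖ ^ 2 ∂surfMeas d = rayleighInf a * ∫ x, a x * u x ^ 2 ∂surfMeas d)
    {v : USphere d → ℝ} {H : USphere d → EuclideanSpace ℝ (Fin d)} (hv : IsH1WithGrad v H) :
    ∫ x, a x * inner ℝ (G x) (H x) ∂surfMeas d =
      rayleighInf a * ∫ x, a x * (u x * v x) ∂surfMeas d := by
  have hA := integral_weight_pos hpos ha
  -- Minimality only allows test functions of zero weighted mean. Subtracting the weighted mean of
  -- `v` leaves the gradient unchanged, and the extra term is `c ∫ a u = 0`.
  set c := (∫ x, a x * v x ∂surfMeas d) / ∫ x, a x ∂surfMeas d with hc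
  have hw := hv.sub_const c
  have hia : Integrable a (surfMeas d) := ha.integrable le_top
  have hwmean : ∫ x, a x * (v x - c) ∂surfMeas d = 0 := by
    simp only [mul_sub]
    rw [integral_sub (integrable_weight_mul ha (hv.memLp_fun.integrable one_le_two))
      (hia.mul_const c), integral_mul_const, hc, mul_div_cancel₀ _ hA.ne', sub_self]
  have key := eulerLagrange_of_minimizer (V := weightedH1 (ha.toLp a))
    (weightedForm_comm ha) (weightedForm_comm ha) (l := rayleighInf a) (fun y hy => by
      have := rayleighInf_mul_le hpos ha hy.1 (integral_eq_zero_of_mem_weightedH1 ha hy)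
      rw [weightedForm_apply, weightedForm_apply]
      simpa only [real_inner_self_eq_norm_sq, Real.norm_eq_abs, sq_abs] using this)
    (toLp_mem_weightedH1 ha h hmean) (by
      simp only [weightedForm_toLp, real_inner_self_eq_norm_sq, Real.norm_eq_abs, sq_abs]
      exact hmin)
    (toLp_mem_weightedH1 ha hw hwmean)
  simp only [weightedForm_toLp] at key
  rw [key]
  congr 1
  have hexp : ∀ x, a x * inner ℝ (u x) (v x - c) = a x * (u x * v x) - a x * u x * c :=
    fun x => by simp; ring
  simp only [hexp]
  have huv : Integrable (fun x => u x * v x) (surfMeas d) :=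
    h.memLp_fun.integrable_mul hv.memLp_fun
  rw [integral_sub (integrable_weight_mul ha huv)
    ((integrable_weight_mul ha (h.memLp_fun.integrable one_le_two)).mul_const c),
    integral_mul_const, hmean]
  ring

theorem exists_rayleigh_minimizer [NeZero d] (hpos : ∀ᵐ x ∂surfMeas d, 0 < a x)
    (ha : MemLp a ⊤ (surfMeas d)) {m : ℝ} (hm : 0 < m) (ham : ∀ᵐ x ∂surfMeas d, m ≤ a x)
    (hmean : ∀ i : Fin d, ∫ x, a x * x.1 i ∂surfMeas d = 0) :
    ∃ (u : USphere d → ℝ) (G : USphere d → EuclideanSpace ℝ (Fin d)),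
      IsH1WithGrad u G ∧ ¬ u =ᵐ[surfMeas d] 0 ∧ ∫ x, a x * u x ∂surfMeas d = 0 ∧
      ∫ x, a x * ‖G x‖ ^ 2 ∂surfMeas d = rayleighInf a * ∫ x, a x * u x ^ 2 ∂surfMeas d := by
  -- The balancing condition on `a` makes a coordinate function admissible.
  have hne : ∃ z ∈ weightedH1 (ha.toLp a), z.1 ≠ 0 := by
    have hx := isH1WithGrad_of_contDiff (contDiff_coord (0 : Fin d))
    refine ⟨_, toLp_mem_weightedH1 ha hx (hmean 0), fun h => ?_⟩
    have h0 : (fun x : USphere d => x.1 0) =ᵐ[surfMeas d] fun _ => 0 :=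
      hx.memLp_fun.coeFn_toLp.symm.trans (by simp only at h; rw [h]; exact Lp.coeFn_zero _ _ _)
    have hcont : Continuous fun x : USphere d => x.1 0 :=
      (contDiff_coord (0 : Fin d)).continuous.comp continuous_subtype_val
    have := congrFun ((hcont.ae_eq_iff_eq _ continuous_const).1 h0)
      ⟨EuclideanSpace.single 0 1, by simp⟩
    simp at this
  obtain ⟨l, z, hz, hz0, hzl, hmin⟩ := exists_minimizer_of_totallyBounded
    (isClosed_weightedH1 (ha.toLp a)) (weightedForm_comm ha) (weightedForm_comm ha) hm
    (le_weightedForm_self ha ham) (le_weightedForm_self ha ham)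
    (fun C => by
      refine (totallyBounded_sphereH1_ball d C).subset (Set.image_mono ?_)
      exact fun z hz => ⟨hz.1.1, hz.2⟩) hne
  have hzH : IsH1WithGrad z.1 z.2 := hz.1
  have hzmean := integral_eq_zero_of_mem_weightedH1 ha hz
  have hz0' : ¬ z.1 =ᵐ[surfMeas d] 0 := fun h => hz0 (Lp.eq_zero_iff_ae_eq_zero.2 h)
  simp only [weightedForm_apply, real_inner_self_eq_norm_sq, Real.norm_eq_abs, sq_abs] at hzl
  have hl : rayleighInf a = l := by
    refine IsLeast.csInf_eq ⟨⟨z.1, z.2, hzH, hz0', hzmean, ?_⟩, ?_⟩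
    · rw [hzl, mul_div_cancel_right₀ _ (integral_weight_sq_pos hpos ha hzH.memLp_fun hz0').ne']
    · rintro _ ⟨v, H, hv, hv0, hvmean, rfl⟩
      rw [le_div_iff₀ (integral_weight_sq_pos hpos ha hv.memLp_fun hv0)]
      have := hmin _ (toLp_mem_weightedH1 ha hv hvmean)
      simpa only [weightedForm_toLp, real_inner_self_eq_norm_sq, Real.norm_eq_abs, sq_abs]
        using this
  exact ⟨z.1, z.2, hzH, hz0', hzmean, by rw [hl, hzl]⟩

/-- Otherwise the minimizer has zero gradient, hence is constant, and its zero weighted mean forces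
it to vanish. -/
theorem rayleighInf_pos [NeZero d] (hd : 2 ≤ d) (hpos : ∀ᵐ x ∂surfMeas d, 0 < a x)
    (ha : MemLp a ⊤ (surfMeas d)) {m : ℝ} (hm : 0 < m) (ham : ∀ᵐ x ∂surfMeas d, m ≤ a x)
    (hmean : ∀ i : Fin d, ∫ x, a x * x.1 i ∂surfMeas d = 0) : 0 < rayleighInf a := by
  obtain ⟨u, G, h, hne, hu, hmin⟩ := exists_rayleigh_minimizer hpos ha hm ham hmean
  have hq := integral_weight_sq_pos hpos ha h.memLp_fun hne
  by_contra! hle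
  have hGle : ∫ x, a x * ‖G x‖ ^ 2 ∂surfMeas d ≤ 0 := by
    rw [hmin]; exact mul_nonpos_of_nonpos_of_nonneg hle hq.le
  have hform := le_weightedForm_self ha ham (h.memLp_grad.toLp G)
  rw [weightedForm_toLp, norm_sq_toLp] at hform
  simp only [real_inner_self_eq_norm_sq] at hform
  have hnn : 0 ≤ ∫ x, ‖G x‖ ^ 2 ∂surfMeas d := integral_nonneg fun x => sq_nonneg _
  obtain ⟨c, hc⟩ := h.ae_eq_const_of_grad_eq_zero hd (by nlinarith)
  rw [integral_congr_ae (hc.mono fun x hx => by simp only [hx] :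
    (fun x => a x * u x) =ᵐ[surfMeas d] fun x => a x * c), integral_mul_const] at hu
  have hc0 := (mul_eq_zero.1 hu).resolve_left (integral_weight_pos hpos ha).ne'
  exact hne (hc.mono fun x hx => by rw [hx, hc0]; rfl)

theorem isLeast_rayleighInf [NeZero d] (hd : 2 ≤ d) (hpos : ∀ᵐ x ∂surfMeas d, 0 < a x)
    (ha : MemLp a ⊤ (surfMeas d)) {m : ℝ} (hm : 0 < m) (ham : ∀ᵐ x ∂surfMeas d, m ≤ a x)
    (hmean : ∀ i : Fin d, ∫ x, a x * x.1 i ∂surfMeas d = 0) :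
    IsLeast {lam : ℝ | lam ≠ 0 ∧ IsSphereEigenvalue a lam} (rayleighInf a) := by
  constructor
  · refine ⟨(rayleighInf_pos hd hpos ha hm ham hmean).ne', ?_⟩
    obtain ⟨u, G, h, hne, hu, hmin⟩ := exists_rayleigh_minimizer hpos ha hm ham hmean
    exact ⟨u, G, h, hne, fun v H hv => h.eulerLagrange hpos ha hu hmin hv⟩
  · rintro lam ⟨hlam, u, G, h, hne, heq⟩
    have hu : ∫ x, a x * u x ∂surfMeas d = 0 := by
      -- Testing with `1` shows that eigenfunctions for nonzero eigenvalues have zero weighted mean;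
      -- testing with `u` identifies the eigenvalue as a Rayleigh quotient.
      have := heq _ _ (isH1WithGrad_const 1)
      simp only [inner_zero_right, mul_zero, integral_zero, mul_one] at this
      exact (mul_eq_zero.1 this.symm).resolve_left hlam
    have h1 := heq u G h
    simp only [real_inner_self_eq_norm_sq, ← pow_two] at h1
    have h2 := rayleighInf_mul_le hpos ha h hu
    rw [h1] at h2
    exact le_of_mul_le_mul_right h2 (integral_weight_sq_pos hpos ha h.memLp_fun hne)

theorem rayleighInf_mul_coord_le [NeZero d] (hpos : ∀ᵐ x ∂surfMeas d, 0 < a x)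
    (ha : MemLp a ⊤ (surfMeas d))
    (hmean : ∀ i : Fin d, ∫ x, a x * x.1 i ∂surfMeas d = 0) (i : Fin d) :
    rayleighInf a * ∫ x, a x * x.1 i ^ 2 ∂surfMeas d ≤
      ∫ x, a x * ‖tgrad (fun y => y i) x.1‖ ^ 2 ∂surfMeas d :=
  rayleighInf_mul_le hpos ha (isH1WithGrad_of_contDiff (contDiff_coord i)) (hmean i)

theorem sum_integral_coord_sq (ha : MemLp a ⊤ (surfMeas d)) :
    ∑ i : Fin d, ∫ x, a x * x.1 i ^ 2 ∂surfMeas d = ∫ x, a x ∂surfMeas d := by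
  rw [← integral_finsetSum]
  · simp only [← Finset.mul_sum, sum_sq_coord, mul_one]
  · exact fun i _ => integrable_weight_mul ha (integrable_of_continuous_sphere
      (((contDiff_coord i).continuous.comp continuous_subtype_val).pow 2))

theorem sum_integral_norm_sq_tgrad_coord (ha : MemLp a ⊤ (surfMeas d)) :
    ∑ i : Fin d, ∫ x, a x * ‖tgrad (fun y => y i) x.1‖ ^ 2 ∂surfMeas d =
      ((d : ℝ) - 1) * ∫ x, a x ∂surfMeas d := by
  simp only [norm_sq_tgrad_coord]
  rw [← integral_finsetSum, ← integral_const_mul]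
  · simp only [← Finset.mul_sum, Finset.sum_sub_distrib, sum_sq_coord]
    simp [mul_comm]
  · exact fun i _ => integrable_weight_mul ha (integrable_of_continuous_sphere
      (continuous_const.sub (((contDiff_coord i).continuous.comp continuous_subtype_val).pow 2)))

theorem rayleighInf_le [NeZero d] (hpos : ∀ᵐ x ∂surfMeas d, 0 < a x) (ha : MemLp a ⊤ (surfMeas d))
    (hmean : ∀ i : Fin d, ∫ x, a x * x.1 i ∂surfMeas d = 0) : rayleighInf a ≤ (d : ℝ) - 1 := by
  have h := Finset.sum_le_sum fun i (_ : i ∈ Finset.univ) =>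
    rayleighInf_mul_coord_le hpos ha hmean i
  rw [← Finset.mul_sum, sum_integral_coord_sq ha, sum_integral_norm_sq_tgrad_coord ha] at h
  exact le_of_mul_le_mul_right h (integral_weight_pos hpos ha)

theorem exists_ae_eq_const_of_rayleighInf_eq [NeZero d] (hd : 2 ≤ d) (hpos : ∀ᵐ x ∂surfMeas d, 0 < a x)
    (ha : MemLp a ⊤ (surfMeas d)) (hmean : ∀ i : Fin d, ∫ x, a x * x.1 i ∂surfMeas d = 0)
    (heq : rayleighInf a = (d : ℝ) - 1) : ∃ c : ℝ, ∀ᵐ x ∂surfMeas d, a x = c := by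
  -- Termwise inequalities whose sums agree are all equalities.
  have hmin : ∀ i : Fin d, rayleighInf a * ∫ x, a x * x.1 i ^ 2 ∂surfMeas d =
      ∫ x, a x * ‖tgrad (fun y => y i) x.1‖ ^ 2 ∂surfMeas d := fun i => by
    refine (Finset.sum_eq_sum_iff_of_le fun i (_ : i ∈ Finset.univ) =>
      rayleighInf_mul_coord_le hpos ha hmean i).1 ?_ i (Finset.mem_univ i)
    rw [← Finset.mul_sum, sum_integral_coord_sq ha, sum_integral_norm_sq_tgrad_coord ha, heq]
  -- `a` is only known to be bounded; its weak differentiability is deduced here from the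
  -- Euler–Lagrange equations of the coordinates, tested with the components of `X`.
  have hH1 : IsH1WithGrad a fun _ => 0 := by
    refine ⟨ha.mono_exponent le_top, MemLp.zero, by simp, fun X hX => ?_⟩
    have hXi : ∀ i, ContDiff ℝ ∞ fun y => X y i := fun i =>
      (EuclideanSpace.proj i : EuclideanSpace ℝ (Fin d) →L[ℝ] ℝ).contDiff.comp hX.1
    have hEL := fun i => (isH1WithGrad_of_contDiff (contDiff_coord i)).eulerLagrange hpos ha
      (hmean i) (hmin i).symm (isH1WithGrad_of_contDiff (hXi i))
    have hsum := Finset.sum_congr rfl fun i (_ : i ∈ Finset.univ) => hEL i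
    rw [← Finset.mul_sum, ← integral_finsetSum, ← integral_finsetSum] at hsum
    · simp only [← Finset.mul_sum, sum_inner_tgrad_coord_tgrad hX.1] at hsum
      have h0 : ∀ x : USphere d, ∑ i, x.1 i * X x.1 i = 0 := fun x => by
        have := hX.2 x
        rw [PiLp.inner_apply] at this
        simpa using this
      simp only [h0] at hsum
      simpa using hsum
    · exact fun i _ => integrable_weight_mul ha (integrable_of_continuous_sphere
        (((contDiff_coord i).mul (hXi i)).continuous.comp continuous_subtype_val))
    · exact fun i _ => integrable_weight_mul ha (integrable_of_continuous_sphere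
        (((contDiff_tgrad (contDiff_coord i)).inner ℝ
          (contDiff_tgrad (hXi i))).continuous.comp continuous_subtype_val))
  exact hH1.ae_eq_const_of_grad_eq_zero hd (by simp)

theorem le_rayleighInf_of_ae_eq_const [NeZero d] (hpos : ∀ᵐ x ∂surfMeas d, 0 < a x)
    (ha : MemLp a ⊤ (surfMeas d)) {m : ℝ} (hm : 0 < m) (ham : ∀ᵐ x ∂surfMeas d, m ≤ a x)
    (hmean : ∀ i : Fin d, ∫ x, a x * x.1 i ∂surfMeas d = 0) {c : ℝ}
    (hc : ∀ᵐ x ∂surfMeas d, a x = c) : (d : ℝ) - 1 ≤ rayleighInf a := by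
  have hint : ∀ f : USphere d → ℝ, ∫ x, a x * f x ∂surfMeas d = c * ∫ x, f x ∂surfMeas d :=
    fun f => by
      rw [← integral_const_mul]
      exact integral_congr_ae (hc.mono fun x hx => congrArg (· * f x) hx)
  have hc0 : 0 < c := by
    obtain ⟨x, hx, hx'⟩ := (hpos.and hc).exists
    rwa [hx'] at hx
  obtain ⟨u, G, h, hne, hu, hmin⟩ := exists_rayleigh_minimizer hpos ha hm ham hmean
  have hq := integral_weight_sq_pos hpos ha h.memLp_fun hne
  rw [hint] at hu
  have hp := h.poincare ((mul_eq_zero.1 hu).resolve_left hc0.ne')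
  rw [hint, hint] at hmin
  rw [hint] at hq
  have hq' : 0 < ∫ x, u x ^ 2 ∂surfMeas d := (mul_pos_iff_of_pos_left hc0).1 hq
  have h2 : ∫ x, ‖G x‖ ^ 2 ∂surfMeas d = rayleighInf a * ∫ x, u x ^ 2 ∂surfMeas d :=
    mul_left_cancel₀ hc0.ne' (by rw [hmin]; ring)
  rw [h2] at hp
  exact le_of_mul_le_mul_right hp hq'

end Weighted

/-! ### The exponent and the conclusion -/

theorem alphaExp_mem_Ioo {n : ℕ} {lam : ℝ} (hlam : 0 < lam) (hle : lam ≤ (n : ℝ) - 2) :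
    alphaExp n lam ∈ Set.Ioo (0 : ℝ) 1 := by
  have h1 : (n : ℝ) - 1 < √(((n : ℝ) - 1) ^ 2 + 4 * lam) :=
    Real.lt_sqrt_of_sq_lt (by linarith)
  -- Since `(n + 1)² - (n - 1)² = 4n`, this amounts to `lam < n`.
  have h2 : √(((n : ℝ) - 1) ^ 2 + 4 * lam) < (n : ℝ) + 1 := by
    rw [Real.sqrt_lt' (by linarith)]
    linarith
  unfold alphaExp
  constructor <;> linarith

theorem lemma5p1 (n : ℕ) (hn : 3 ≤ n) (a : USphere (n - 1) → ℝ)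
    (ha_pos : ∀ᵐ x ∂(surfMeas (n - 1)), 0 < a x)
    (ha_log : MemLp (fun x => Real.log (a x)) (⊤ : ENNReal) (surfMeas (n - 1)))
    (ha_mean : ∀ i : Fin (n - 1), ∫ x, a x * x.1 i ∂(surfMeas (n - 1)) = 0) :
    IsLeast {lam : ℝ | lam ≠ 0 ∧ IsSphereEigenvalue a lam} (rayleighInf a) ∧
    rayleighInf a ≤ (n : ℝ) - 2 ∧
    (rayleighInf a = (n : ℝ) - 2 ↔ ∃ c : ℝ, ∀ᵐ x ∂(surfMeas (n - 1)), a x = c) ∧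
    alphaExp n (rayleighInf a) ∈ Set.Ioo (0 : ℝ) 1 := by
  have hd : 2 ≤ n - 1 := by omega
  have : NeZero (n - 1) := ⟨by omega⟩
  have hcast : ((n - 1 : ℕ) : ℝ) - 1 = (n : ℝ) - 2 := by
    rw [Nat.cast_sub (by omega)]; push_cast; ring
  obtain ⟨ha, m, hm, ham⟩ := exists_bounds_of_memLp_log ha_pos ha_log
  have hle := rayleighInf_le ha_pos ha ha_mean
  rw [hcast] at hle
  refine ⟨isLeast_rayleighInf hd ha_pos ha hm ham ha_mean, hle, ⟨fun h => ?_, ?_⟩,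
    alphaExp_mem_Ioo (rayleighInf_pos hd ha_pos ha hm ham ha_mean) hle⟩
  · exact exists_ae_eq_const_of_rayleighInf_eq hd ha_pos ha ha_mean (by rw [h, hcast])
  · rintro ⟨c, hc⟩
    have := le_rayleighInf_of_ae_eq_const ha_pos ha hm ham ha_mean hc
    rw [hcast] at this
    exact hle.antisymm this
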